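/- Let $q$ be a complex number with $0<|q|<1$. Fix any fourth root $q^{1/4}$ of $q$, and write $q^{n/4}:=(q^{1/4})^n$ for $n\in\mathbb Z$. Put $$(a;q)_n:=\prod_{k=0}^{n-1}(1-aq^k),\qquad (a;q)_\infty:=\prod_{k=0}^{\infty}(1-aq^k),$$ $$J_m:=(q^m;q^m)_\infty,\qquad J_{a,m}:=(q^a;q^m)_\infty\,(q^{m-a};q^m)_\infty\,(q^m;q^m)_\infty .$$ For all complex $u,v,w,t$ the series $$F(u,v,w,t;q^2):=\sum_{i,j,k,l\ge 0}\frac{u^iv^jw^kt^l\,q^{i^2+j^2+k^2+5l^2/4-il-jl+kl}}{(q^2;q^2)_i(q^2;q^2)_j(q^2;q^2)_k(q^2;q^2)_l}$$ converges absolutely and satisfies $$F(u,v,w,t;q^2)=F(v,u,w,t;q^2).$$ Moreover, $$F(q^{-1},q,q^{-1},q^{-1/2};q^2)=4\frac{J_4^3J_{8,20}}{J_2^4}+q^{-1/4}\frac{J_2^7J_{3,10}J_{4,20}}{J_1^4J_4^4J_{20}},$$ $$F(1,1,1,q^{-1};q^2)=\frac{J_2^7J_{3,10}J_{4,20}}{J_1^4J_4^4J_{20}}+4q^{1/4}\frac{J_4^3J_{8,20}}{J_2^4},$$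 $$F(1,1,1,1;q^2)=\frac{J_2^7J_{1,10}J_{8,20}}{J_1^4J_4^4J_{20}}+4q^{5/4}\frac{J_4^3J_{4,20}}{J_2^4}.$$ -/

import Mathlib

/-- The finite `q`-shifted factorial `(a;q)_n = ∏_{k=0}^{n-1} (1 - a q^k)`. -/
noncomputable def qPoch (a q : ℂ) (n : ℕ) : ℂ :=
  ∏ k ∈ Finset.range n, (1 - a * q ^ k)

/-- The infinite `q`-shifted factorial `(a;q)_∞ = ∏_{k=0}^∞ (1 - a q^k)`. -/
noncomputable def qPochInf (a q : ℂ) : ℂ :=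
  ∏' k : ℕ, (1 - a * q ^ k)

/-- The infinite product defining `(a;q)_∞` converges whenever `|q| < 1`. -/
theorem multipliable_qPochInf (a : ℂ) {q : ℂ} (hq : ‖q‖ < 1) :
    Multipliable fun k : ℕ => (1 - a * q ^ k) := by
  have h : Summable fun k : ℕ => ‖-(a * q ^ k)‖ := by
    simp only [norm_neg, norm_mul, norm_pow]
    exact (summable_geometric_of_lt_one (norm_nonneg q) hq).mul_left ‖a‖
  simpa [sub_eq_add_neg] using multipliable_one_add_of_summable h

/-- `J_m = (q^m;q^m)_∞`. -/
noncomputable def qJ (q : ℂ) (m : ℕ) : ℂ :=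
  qPochInf (q ^ m) (q ^ m)

/-- `J_{a,m} = (q^a, q^{m-a}, q^m; q^m)_∞`. -/
noncomputable def qJ₂ (q : ℂ) (a : ℤ) (m : ℕ) : ℂ :=
  qPochInf (q ^ a) (q ^ m) * qPochInf (q ^ ((m : ℤ) - a)) (q ^ m) * qPochInf (q ^ m) (q ^ m)

/-- The general term of the quadruple series. The variable `r` is a chosen fourth root of `q`,
so `q = r ^ 4` and
`q^{i²+j²+k²+5l²/4-il-jl+kl} = r^{4i²+4j²+4k²+5l²-4il-4jl+4kl}`. -/
noncomputable def nahmTerm (r u v w t : ℂ) (n : ℕ × ℕ × ℕ × ℕ) : ℂ :=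
  match n with
  | (i, j, k, l) =>
    u ^ i * v ^ j * w ^ k * t ^ l *
        r ^ (4 * (i : ℤ) ^ 2 + 4 * (j : ℤ) ^ 2 + 4 * (k : ℤ) ^ 2 + 5 * (l : ℤ) ^ 2
          - 4 * (i : ℤ) * l - 4 * (j : ℤ) * l + 4 * (k : ℤ) * l) /
      (qPoch ((r ^ 4) ^ 2) ((r ^ 4) ^ 2) i * qPoch ((r ^ 4) ^ 2) ((r ^ 4) ^ 2) j *
        qPoch ((r ^ 4) ^ 2) ((r ^ 4) ^ 2) k * qPoch ((r ^ 4) ^ 2) ((r ^ 4) ^ 2) l)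

/-- The quadruple series `F(u,v,w,t;q²)`, where `q = r ^ 4`. -/
noncomputable def nahmF (r u v w t : ℂ) : ℂ :=
  ∑' n : ℕ × ℕ × ℕ × ℕ, nahmTerm r u v w t n

/-! For fixed `l` the exponent has no cross terms among `i`, `j`, `k`, so Euler's identity in base
`q²` sums these three indices and leaves `(-u q^{1-l}, -v q^{1-l}, -w q^{1+l}; q²)_∞`. This form is
symmetric in `u` and `v`. Splitting `l` by parity and pulling the negative powers of `q` out of the
shifted products (`qPochInf_neg_zpow_odd`, `qPochInf_neg_zpow_even`) turns each specialisation into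
two single series, each multiplied by the cube of `(-q;q²)_∞` or of `(-q²;q²)_∞`.

These single series are of Slater type. `tsum_convolution` evaluates each of them: a double sum with
exponent `(m+k)² + c(m+k)` is computed once over `k` by Euler and once along `N = m+k`, where the
inner finite sum is a coefficient of a product of formal q-exponentials. One or two such steps reach
the Rogers–Ramanujan series `rrG`, `rrH` at `-q` or `q⁴`.

The Rogers–Ramanujan identities are proved by comparing `∑ q^{n²+kn}/(q;q)_n` with Selberg's
alternating series: both satisfy the same recurrence in `k` and tend to 1, which forces equality
(`eq_zero_of_recurrence`). At `a = q` the Selberg series is a theta series, and the Jacobi triple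
product gives its product form. Elementary product manipulations (`even_product`, `odd_product`)
then produce the stated quotients. -/

open Filter Topology

/-! ### q-shifted factorials and Euler's identity -/

section Basic

variable {q : ℂ}

theorem qPoch_zero (a q : ℂ) : qPoch a q 0 = 1 := by simp [qPoch]

theorem qPoch_succ (a q : ℂ) (n : ℕ) : qPoch a q (n + 1) = qPoch a q n * (1 - a * q ^ n) :=
  Finset.prod_range_succ _ _

theorem qPoch_succ' (a q : ℂ) (n : ℕ) : qPoch a q (n + 1) = (1 - a) * qPoch (a * q) q n := by
  rw [qPoch, Finset.prod_range_succ', mul_comm]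
  simp [qPoch, pow_succ', mul_assoc]

theorem tendsto_qPoch (a : ℂ) (hq : ‖q‖ < 1) :
    Tendsto (qPoch a q) atTop (𝓝 (qPochInf a q)) :=
  (multipliable_qPochInf a hq).hasProd.tendsto_prod_nat

theorem qPochInf_eq_qPoch_mul (a : ℂ) (hq : ‖q‖ < 1) (n : ℕ) :
    qPochInf a q = qPoch a q n * qPochInf (a * q ^ n) q := by
  have h := (tendsto_qPoch (a * q ^ n) hq).const_mul (qPoch a q n)
  refine tendsto_nhds_unique ((tendsto_add_atTop_iff_nat n).2 (tendsto_qPoch a hq)) ?_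
  refine h.congr fun m => ?_
  rw [qPoch, qPoch, qPoch, add_comm m n, Finset.prod_range_add]
  congr 1
  exact Finset.prod_congr rfl fun k _ => by rw [pow_add, mul_assoc]

theorem qPochInf_eq_one_sub_mul (a : ℂ) (hq : ‖q‖ < 1) :
    qPochInf a q = (1 - a) * qPochInf (a * q) q := by
  simpa [qPoch] using qPochInf_eq_qPoch_mul a hq 1

theorem qPochInf_ne_zero {a : ℂ} (hq : ‖q‖ < 1) (h : ∀ n, 1 - a * q ^ n ≠ 0) :
    qPochInf a q ≠ 0 := by
  have hs : Summable fun k : ℕ => ‖-(a * q ^ k)‖ := by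
    simp only [norm_neg, norm_mul, norm_pow]
    exact (summable_geometric_of_lt_one (norm_nonneg q) hq).mul_left ‖a‖
  have := tprod_one_add_ne_zero_of_summable (f := fun n : ℕ => -(a * q ^ n))
    (fun i => by simpa [sub_eq_add_neg] using h i) hs
  simpa [qPochInf, sub_eq_add_neg] using this

theorem one_sub_ne_zero_of_norm_lt {a : ℂ} (h : ‖a‖ < 1) : 1 - a ≠ 0 := by
  intro h0
  rw [← sub_eq_zero.1 h0] at h
  simp at h

theorem norm_mul_pow_lt_one {a : ℂ} (ha : ‖a‖ < 1) (hq : ‖q‖ < 1) (n : ℕ) :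
    ‖a * q ^ n‖ < 1 := by
  rw [norm_mul, norm_pow]
  exact mul_lt_one_of_nonneg_of_lt_one_left (norm_nonneg _) ha
    (pow_le_one₀ (norm_nonneg _) hq.le)

theorem qPochInf_ne_zero_of_norm_lt {a : ℂ} (ha : ‖a‖ < 1) (hq : ‖q‖ < 1) :
    qPochInf a q ≠ 0 :=
  qPochInf_ne_zero hq fun n => one_sub_ne_zero_of_norm_lt (norm_mul_pow_lt_one ha hq n)

theorem qPoch_ne_zero_of_norm_lt {a : ℂ} (ha : ‖a‖ < 1) (hq : ‖q‖ < 1) (n : ℕ) :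
    qPoch a q n ≠ 0 :=
  Finset.prod_ne_zero_iff.2 fun k _ => one_sub_ne_zero_of_norm_lt (norm_mul_pow_lt_one ha hq k)

theorem exists_norm_qPoch_le (a : ℂ) (hq : ‖q‖ < 1) : ∃ C, ∀ n, ‖qPoch a q n‖ ≤ C := by
  obtain ⟨C, hC⟩ := (tendsto_qPoch a hq).norm.bddAbove_range
  exact ⟨C, fun n => hC ⟨n, rfl⟩⟩

theorem exists_norm_inv_qPoch_le {a : ℂ} (ha : ‖a‖ < 1) (hq : ‖q‖ < 1) :
    ∃ C, 0 ≤ C ∧ ∀ n, ‖(qPoch a q n)⁻¹‖ ≤ C := by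
  obtain ⟨C, hC⟩ :=
    ((tendsto_qPoch a hq).inv₀ (qPochInf_ne_zero_of_norm_lt ha hq)).norm.bddAbove_range
  have h : ∀ n, ‖(qPoch a q n)⁻¹‖ ≤ C := fun n => hC ⟨n, rfl⟩
  exact ⟨C, (norm_nonneg _).trans (h 0), h⟩

/-- The ratio of consecutive terms is `ρ ^ n * M → 0`, so no bound on `M` is needed. This is the
majorant for the Euler, theta and Nahm-type series below. -/
theorem summable_pow_choose_two_mul_pow {ρ : ℝ} (h0 : 0 ≤ ρ) (h1 : ρ < 1) (M : ℝ) :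
    Summable fun n : ℕ => ρ ^ n.choose 2 * M ^ n := by
  refine summable_of_ratio_norm_eventually_le (r := 1 / 2) (by norm_num) ?_
  have ht : Tendsto (fun n : ℕ => ρ ^ n * |M|) atTop (𝓝 0) := by
    simpa using (tendsto_pow_atTop_nhds_zero_of_lt_one h0 h1).mul_const |M|
  filter_upwards [ht.eventually (ge_mem_nhds (show (0 : ℝ) < 1 / 2 by norm_num))] with n hn
  have : ρ ^ (n + 1).choose 2 * M ^ (n + 1) = ρ ^ n * M * (ρ ^ n.choose 2 * M ^ n) := by
    rw [Nat.choose_succ_succ' n 1, Nat.choose_one_right]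
    ring
  rw [this, norm_mul]
  refine mul_le_mul_of_nonneg_right ?_ (norm_nonneg _)
  simpa [abs_of_nonneg h0] using hn

theorem choose_two_succ (n : ℕ) : (n + 1).choose 2 = n + n.choose 2 := by
  rw [Nat.choose_succ_succ' n 1, Nat.choose_one_right]

theorem summable_norm_euler (hq : ‖q‖ < 1) (z : ℂ) :
    Summable fun n : ℕ => ‖q ^ n.choose 2 * z ^ n / qPoch q q n‖ := by
  obtain ⟨C, hC, h⟩ := exists_norm_inv_qPoch_le hq hq
  refine Summable.of_nonneg_of_le (fun _ => norm_nonneg _) (fun n => ?_)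
    ((summable_pow_choose_two_mul_pow (norm_nonneg q) hq ‖z‖).mul_right C)
  rw [div_eq_mul_inv, norm_mul, norm_mul, norm_pow, norm_pow]
  exact mul_le_mul_of_nonneg_left (h n) (by positivity)

/-- Subtracting the series at `z * q` from the one at `z` puts `1 - q ^ n` on the `n`-th term; this
cancels the last factor of `(q;q)_n`, and an index shift remains. -/
theorem tsum_euler_functional (hq : ‖q‖ < 1) (z : ℂ) :
    ∑' n : ℕ, q ^ n.choose 2 * z ^ n / qPoch q q n =
      (1 + z) * ∑' n : ℕ, q ^ n.choose 2 * (z * q) ^ n / qPoch q q n := by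
  have h1 := (summable_norm_euler hq z).of_norm
  have h2 := (summable_norm_euler hq (z * q)).of_norm
  rw [one_add_mul, ← tsum_mul_left, ← sub_eq_iff_eq_add', ← h1.tsum_sub h2,
    (h1.sub h2).tsum_eq_zero_add]
  simp only [pow_zero, Nat.choose_zero_succ, sub_self, zero_add]
  refine tsum_congr fun n => ?_
  have hn := qPoch_ne_zero_of_norm_lt hq hq n
  have hn' := qPoch_ne_zero_of_norm_lt hq hq (n + 1)
  rw [qPoch_succ] at hn' ⊢
  rw [choose_two_succ, ← sub_div, ← mul_div_assoc, div_eq_div_iff hn' hn]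
  ring

/-- **Euler's identity** for `(-z;q)_∞`. -/
theorem tsum_euler (hq : ‖q‖ < 1) (z : ℂ) :
    ∑' n : ℕ, q ^ n.choose 2 * z ^ n / qPoch q q n = qPochInf (-z) q := by
  set E : ℂ → ℂ := fun z => ∑' n : ℕ, q ^ n.choose 2 * z ^ n / qPoch q q n with hE
  have hiter : ∀ n : ℕ, E z = qPoch (-z) q n * E (z * q ^ n) := by
    intro n
    induction n with
    | zero => simp [qPoch]
    | succ n ih =>
      rw [ih, qPoch_succ, hE]
      dsimp only
      rw [tsum_euler_functional hq (z * q ^ n)]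
      ring_nf
  -- As the argument tends to 0 only the constant term survives, so the iterated functional equation
  -- becomes the infinite product.
  have hlim : Tendsto (fun n : ℕ => E (z * q ^ n)) atTop (𝓝 1) := by
    have h1 : ∑' n : ℕ, (if n = 0 then (1 : ℂ) else 0) = 1 := by simp
    rw [← h1]
    refine tendsto_tsum_of_dominated_convergence (summable_norm_euler hq z) ?_ ?_
    · intro k
      rcases eq_or_ne k 0 with rfl | hk
      · simp [qPoch]
      · have : Tendsto (fun n : ℕ => (z * q ^ n)) atTop (𝓝 0) := by
          simpa using (tendsto_pow_atTop_nhds_zero_of_norm_lt_one hq).const_mul z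
        simpa [hk] using ((this.pow k).const_mul (q ^ k.choose 2)).div_const (qPoch q q k)
    · refine Eventually.of_forall fun n k => ?_
      rw [norm_div, norm_div, norm_mul, norm_mul, mul_pow, norm_mul]
      gcongr
      refine mul_le_of_le_one_right (norm_nonneg _) ?_
      rw [norm_pow, norm_pow]
      exact pow_le_one₀ (by positivity) (pow_le_one₀ (norm_nonneg _) hq.le)
  refine tendsto_nhds_unique (tendsto_const_nhds (x := E z) (f := atTop (α := ℕ))) ?_
  have := (tendsto_qPoch (-z) hq).mul hlim
  rw [mul_one] at this
  exact this.congr fun n => (hiter n).symm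

end Basic

/-! ### Formal q-exponentials and their factorisations -/

section Formal

open PowerSeries Finset

/-- The formal series `∑ yⁿ / (q;q)_n`. -/
noncomputable def eulerInv (q : ℂ) : PowerSeries ℂ := PowerSeries.mk fun n => (qPoch q q n)⁻¹

/-- The formal series `∑ q^{n(n-1)/2} yⁿ / (q;q)_n`. -/
noncomputable def eulerExp (q : ℂ) : PowerSeries ℂ :=
  PowerSeries.mk fun n => q ^ n.choose 2 * (qPoch q q n)⁻¹

variable {q : ℂ}

theorem one_sub_pow_ne_zero (hq : ‖q‖ < 1) {n : ℕ} (hn : n ≠ 0) : 1 - q ^ n ≠ 0 :=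
  one_sub_ne_zero_of_norm_lt (by rw [norm_pow]; exact pow_lt_one₀ (norm_nonneg _) hq hn)

theorem inv_qPoch_succ (hq : ‖q‖ < 1) (n : ℕ) :
    (qPoch q q (n + 1))⁻¹ * (1 - q ^ (n + 1)) = (qPoch q q n)⁻¹ := by
  have h := one_sub_pow_ne_zero hq n.succ_ne_zero
  rw [qPoch_succ, mul_inv, ← pow_succ', mul_assoc, inv_mul_cancel₀ h, mul_one]

theorem coeff_zero_rescale (a : ℂ) (f : PowerSeries ℂ) : coeff 0 (rescale a f) = coeff 0 f := by
  rw [coeff_rescale, pow_zero, one_mul]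

theorem coeff_zero_eulerInv (q : ℂ) : coeff 0 (eulerInv q) = 1 := by
  rw [eulerInv, coeff_mk, qPoch_zero, inv_one]

theorem coeff_zero_eulerExp (q : ℂ) : coeff 0 (eulerExp q) = 1 := by
  rw [eulerExp, coeff_mk, qPoch_zero, inv_one, Nat.choose_zero_succ, pow_zero, one_mul]

theorem one_sub_X_mul_eulerInv (hq : ‖q‖ < 1) :
    (1 - X) * eulerInv q = rescale q (eulerInv q) := by
  ext n
  rw [sub_mul, one_mul, map_sub, coeff_rescale]
  cases n with
  | zero => simp [eulerInv, qPoch]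
  | succ n =>
    rw [coeff_succ_X_mul, eulerInv, coeff_mk, coeff_mk, ← inv_qPoch_succ hq n]
    ring

theorem eulerExp_eq_one_add_X_mul (hq : ‖q‖ < 1) :
    eulerExp q = (1 + X) * rescale q (eulerExp q) := by
  ext n
  rw [add_mul, one_mul, map_add, coeff_rescale]
  cases n with
  | zero => simp [eulerExp, qPoch]
  | succ n =>
    rw [coeff_succ_X_mul, coeff_rescale, eulerExp, coeff_mk, coeff_mk, ← inv_qPoch_succ hq n,
      choose_two_succ]
    ring

theorem eq_one_of_rescale_eq (hq : ‖q‖ < 1) {f : PowerSeries ℂ} (h0 : coeff 0 f = 1)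
    (h : rescale q f = f) : f = 1 := by
  ext n
  rcases eq_or_ne n 0 with rfl | hn
  · simpa using h0
  · have := congrArg (coeff n) h
    rw [coeff_rescale] at this
    rw [coeff_one, if_neg hn]
    have h2 : (1 - q ^ n) * coeff n f = 0 := by rw [sub_mul, this]; ring
    exact (mul_eq_zero.1 h2).resolve_left (one_sub_pow_ne_zero hq hn)

theorem eq_eulerInv_of_functional (hq : ‖q‖ < 1) {f : PowerSeries ℂ} (h0 : coeff 0 f = 1)
    (h : (1 - X) * f = rescale q f) : f = eulerInv q := by
  ext n
  induction n with
  | zero => rw [h0]; simp [eulerInv, qPoch]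
  | succ n ih =>
    have := congrArg (coeff (n + 1)) h
    rw [sub_mul, one_mul, map_sub, coeff_rescale, coeff_succ_X_mul, ih] at this
    refine mul_right_cancel₀ (one_sub_pow_ne_zero hq n.succ_ne_zero) ?_
    rw [eulerInv, coeff_mk] at this ⊢
    rw [inv_qPoch_succ hq n, Nat.succ_eq_add_one]
    linear_combination this

/-- Formally this is `(y;q)_∞ · 1/(y;q)_∞ = 1`. By the two functional equations the product is
invariant under `y ↦ qy`, hence constant because `q ^ n ≠ 1` for `n > 0`. -/
theorem rescale_neg_one_eulerExp_mul (hq : ‖q‖ < 1) :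
    rescale (-1) (eulerExp q) * eulerInv q = 1 := by
  refine eq_one_of_rescale_eq hq (by
    simp only [coeff_mul, Nat.antidiagonal_zero, sum_singleton, coeff_zero_rescale,
      coeff_zero_eulerInv, coeff_zero_eulerExp, mul_one]) ?_
  have h := congrArg (rescale (-1 : ℂ)) (eulerExp_eq_one_add_X_mul hq)
  have hX : rescale (-1 : ℂ) (X : PowerSeries ℂ) = -X := by
    rw [rescale_X]; simp
  rw [map_mul, map_add, map_one, hX, rescale_rescale] at h
  rw [map_mul, ← one_sub_X_mul_eulerInv hq, rescale_rescale, mul_comm (-1 : ℂ) q]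
  conv_rhs => rw [h]
  ring_nf

theorem rescale_neg_eulerExp_mul (hq : ‖q‖ < 1) (a : ℂ) :
    rescale (-a) (eulerExp q) * rescale a (eulerInv q) = 1 := by
  have := congrArg (rescale a) (rescale_neg_one_eulerExp_mul hq)
  rw [map_mul, rescale_rescale, map_one] at this
  simpa using this

theorem norm_sq_lt_one (hq : ‖q‖ < 1) : ‖q ^ 2‖ < 1 := by
  rw [norm_pow]; exact pow_lt_one₀ (norm_nonneg _) hq two_ne_zero

/-- This encodes `(y;q)_∞ = (y;q²)_∞ (qy;q²)_∞`: the right side satisfies the functional equation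
that determines `eulerInv q`. The next four lemmas cancel one of the two factors. -/
theorem eulerInv_eq_mul (hq : ‖q‖ < 1) :
    eulerInv q = eulerInv (q ^ 2) * rescale q (eulerInv (q ^ 2)) := by
  symm
  refine eq_eulerInv_of_functional hq (by
    simp only [coeff_mul, Nat.antidiagonal_zero, sum_singleton, coeff_zero_rescale,
      coeff_zero_eulerInv, mul_one]) ?_
  rw [map_mul, rescale_rescale, ← sq, ← mul_assoc, one_sub_X_mul_eulerInv (norm_sq_lt_one hq)]
  ring

theorem rescale_neg_eulerExp_sq_mul (hq : ‖q‖ < 1) :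
    rescale (-q) (eulerExp (q ^ 2)) * eulerInv q = eulerInv (q ^ 2) := by
  rw [eulerInv_eq_mul hq]
  linear_combination (eulerInv (q ^ 2)) * rescale_neg_eulerExp_mul (norm_sq_lt_one hq) q

theorem rescale_neg_one_eulerExp_sq_mul (hq : ‖q‖ < 1) :
    rescale (-1) (eulerExp (q ^ 2)) * eulerInv q = rescale q (eulerInv (q ^ 2)) := by
  rw [eulerInv_eq_mul hq]
  linear_combination (rescale q (eulerInv (q ^ 2))) *
    rescale_neg_one_eulerExp_mul (norm_sq_lt_one hq)

theorem eulerExp_mul_rescale_neg_one (hq : ‖q‖ < 1) :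
    eulerExp q * rescale (-1) (eulerInv (q ^ 2)) = rescale q (eulerExp (q ^ 2)) := by
  have h1 := rescale_neg_eulerExp_mul hq (-1)
  have h3 := rescale_neg_eulerExp_mul (norm_sq_lt_one hq) (-q)
  rw [eulerInv_eq_mul hq, map_mul, rescale_rescale, mul_neg_one] at h1
  simp only [neg_neg, rescale_one, RingHom.id_apply] at h1 h3
  linear_combination (rescale q (eulerExp (q ^ 2))) * h1 -
    eulerExp q * rescale (-1) (eulerInv (q ^ 2)) * h3

theorem eulerExp_mul_rescale_neg (hq : ‖q‖ < 1) :
    eulerExp q * rescale (-q) (eulerInv (q ^ 2)) = eulerExp (q ^ 2) := by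
  have h1 := rescale_neg_eulerExp_mul hq (-1)
  have h2 := rescale_neg_eulerExp_mul (norm_sq_lt_one hq) (-1)
  rw [eulerInv_eq_mul hq, map_mul, rescale_rescale, mul_neg_one] at h1
  simp only [neg_neg, rescale_one, RingHom.id_apply] at h1 h2
  linear_combination (eulerExp (q ^ 2)) * h1 - eulerExp q * rescale (-q) (eulerInv (q ^ 2)) * h2

end Formal

/-! ### The convolution principle -/

section Convolution

open Finset

variable {x : ℂ}

theorem tsum_euler_sq (hx : ‖x‖ < 1) (y : ℂ) :
    ∑' k : ℕ, x ^ k ^ 2 * (y ^ k * (qPoch (x ^ 2) (x ^ 2) k)⁻¹) = qPochInf (-(x * y)) (x ^ 2) := by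
  rw [← tsum_euler (norm_sq_lt_one hx)]
  refine tsum_congr fun k => ?_
  have : k ^ 2 = 2 * k.choose 2 + k := by
    rw [Nat.choose_two_right, Nat.mul_div_cancel' (Nat.even_mul_pred_self k).two_dvd]
    cases k with
    | zero => rfl
    | succ k => simp; ring
  rw [this, pow_add, pow_mul, mul_pow, div_eq_mul_inv]
  ring

/-- Both sides are the double sum of `x^{(m+k)²+c(m+k)} A_m s^k/(x²;x²)_k`. Summing over `k` first
gives the left side; collecting `m + k = N` gives the right side. -/
theorem tsum_convolution (hx : ‖x‖ < 1) (c : ℕ) {s : ℂ} (hs : ‖s‖ ≤ 1) {A : ℕ → ℂ} {M : ℝ}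
    (hA : ∀ m, ‖A m‖ ≤ M) {C : ℕ → ℂ}
    (hC : ∀ N, ∑ p ∈ antidiagonal N, A p.1 * (s ^ p.2 * (qPoch (x ^ 2) (x ^ 2) p.2)⁻¹) = C N) :
    ∑' m : ℕ, A m * (x ^ (m ^ 2 + c * m) * qPochInf (-(x ^ (2 * m + c + 1) * s)) (x ^ 2)) =
      ∑' N : ℕ, x ^ (N ^ 2 + c * N) * C N := by
  have hx2 := norm_sq_lt_one hx
  obtain ⟨D, hD0, hD⟩ := exists_norm_inv_qPoch_le hx2 hx2
  have hM : 0 ≤ M := (norm_nonneg _).trans (hA 0)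
  set f : ℕ × ℕ → ℂ := fun p => x ^ ((p.1 + p.2) ^ 2 + c * (p.1 + p.2)) *
    (A p.1 * (s ^ p.2 * (qPoch (x ^ 2) (x ^ 2) p.2)⁻¹)) with hf
  have hsum : Summable f := by
    have hg := summable_geometric_of_lt_one (norm_nonneg x) hx
    refine Summable.of_norm_bounded (g := fun p : ℕ × ℕ => ‖x‖ ^ p.1 * ‖x‖ ^ p.2 * (M * (1 * D)))
      ((hg.mul_of_nonneg hg (fun _ => by positivity) (fun _ => by positivity)).mul_right _) ?_
    rintro ⟨m, k⟩
    simp only [hf, norm_mul, norm_pow]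
    rw [← pow_add]
    have h1 : ‖x‖ ^ ((m + k) ^ 2 + c * (m + k)) ≤ ‖x‖ ^ (m + k) :=
      pow_le_pow_of_le_one (norm_nonneg _) hx.le
        ((Nat.le_self_pow two_ne_zero (m + k)).trans (Nat.le_add_right _ _))
    have h2 : ‖s‖ ^ k ≤ 1 := pow_le_one₀ (norm_nonneg _) hs
    have h3 := hD k
    have h4 := hA m
    gcongr
  have hL : ∑' p, f p = ∑' N : ℕ, x ^ (N ^ 2 + c * N) * C N := by
    have hs' : Summable fun z : (Σ n : ℕ, antidiagonal n) =>
        f (HasAntidiagonal.sigmaAntidiagonalEquivProd z) :=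
      (HasAntidiagonal.sigmaAntidiagonalEquivProd.summable_iff (f := f)).2 hsum
    rw [← HasAntidiagonal.sigmaAntidiagonalEquivProd.tsum_eq f, hs'.tsum_sigma]
    refine tsum_congr fun N => ?_
    rw [tsum_fintype, ← hC N, mul_sum, ← Finset.sum_coe_sort (antidiagonal N)]
    refine Finset.sum_congr rfl fun p _ => ?_
    have := mem_antidiagonal.1 p.2
    simp [hf, HasAntidiagonal.sigmaAntidiagonalEquivProd, this]
  rw [← hL, hsum.tsum_prod]
  refine tsum_congr fun m => ?_
  -- The exponent equals `m² + cm + k² + (2m+c)k`, so the cross term becomes part of the argument.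
  have h := tsum_euler_sq hx (x ^ (2 * m + c) * s)
  rw [← mul_assoc, ← pow_succ'] at h
  rw [← h, ← mul_assoc, ← tsum_mul_left]
  refine tsum_congr fun k => ?_
  simp only [hf]
  rw [mul_pow, ← pow_mul]
  ring

end Convolution

/-! ### Slater-type series reduced to Rogers–Ramanujan series -/

section SingleSums

/-- The first Rogers–Ramanujan series. -/
noncomputable def rrG (x : ℂ) : ℂ := ∑' n : ℕ, x ^ n ^ 2 * (qPoch x x n)⁻¹

/-- The second Rogers–Ramanujan series. -/
noncomputable def rrH (x : ℂ) : ℂ := ∑' n : ℕ, x ^ (n ^ 2 + n) * (qPoch x x n)⁻¹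

variable {q x : ℂ}

theorem qPochInf_mul_pow {a : ℂ} (ha : ‖a‖ < 1) (hq : ‖q‖ < 1) (n : ℕ) :
    qPochInf (a * q ^ n) q = qPochInf a q * (qPoch a q n)⁻¹ := by
  rw [qPochInf_eq_qPoch_mul a hq n, mul_right_comm,
    mul_inv_cancel₀ (qPoch_ne_zero_of_norm_lt ha hq n), one_mul]

theorem qPoch_mul_neg (a q : ℂ) (n : ℕ) :
    qPoch a q n * qPoch (-a) q n = qPoch (a ^ 2) (q ^ 2) n := by
  simp only [qPoch, ← Finset.prod_mul_distrib]
  exact Finset.prod_congr rfl fun k _ => by ring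

theorem norm_pow_lt_one' (hq : ‖q‖ < 1) {n : ℕ} (hn : n ≠ 0) : ‖q ^ n‖ < 1 := by
  rw [norm_pow]; exact pow_lt_one₀ (norm_nonneg _) hq hn

theorem qPoch_two_mul (a q : ℂ) (n : ℕ) :
    qPoch a q (2 * n) = qPoch a (q ^ 2) n * qPoch (a * q) (q ^ 2) n := by
  induction n with
  | zero => simp [qPoch]
  | succ n ih =>
    rw [show 2 * (n + 1) = 2 * n + 1 + 1 from rfl, qPoch_succ, qPoch_succ, ih, qPoch_succ,
      qPoch_succ]
    ring

theorem qPochInf_mul_qPochInf_mul (a : ℂ) (hq : ‖q‖ < 1) :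
    qPochInf a (q ^ 2) * qPochInf (a * q) (q ^ 2) = qPochInf a q := by
  have hq2 := norm_sq_lt_one hq
  have h := (tendsto_qPoch a hq).comp (tendsto_id.const_mul_atTop' (r := 2) two_pos)
  refine tendsto_nhds_unique ((tendsto_qPoch a hq2).mul (tendsto_qPoch (a * q) hq2)) ?_
  exact h.congr fun n => qPoch_two_mul a q n

theorem exists_norm_mul_inv_qPoch_le (hq : ‖q‖ < 1) {f : ℕ → ℂ} (hf : ∀ n, ‖f n‖ ≤ 1) :
    ∃ M, ∀ n, ‖f n * (qPoch q q n)⁻¹‖ ≤ M := by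
  obtain ⟨D, -, hD⟩ := exists_norm_inv_qPoch_le hq hq
  refine ⟨1 * D, fun n => ?_⟩
  rw [norm_mul]
  exact mul_le_mul (hf n) (hD n) (norm_nonneg _) zero_le_one

theorem norm_pow_le_one (hq : ‖q‖ < 1) (n : ℕ) : ‖q ^ n‖ ≤ 1 := by
  rw [norm_pow]; exact pow_le_one₀ (norm_nonneg _) hq.le

open Finset PowerSeries

theorem sum_antidiagonal_of_mul_eq {f g h : PowerSeries ℂ} (H : f * g = h) (N : ℕ) :
    ∑ p ∈ antidiagonal N, coeff p.1 f * coeff p.2 g = coeff N h := by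
  rw [← H, coeff_mul]

/-- Convolution for `1/(y;x)_∞ = 1/(y;x²)_∞ · 1/(xy;x²)_∞`; the denominators merge by `(x²;x²)_m
(-x²;x²)_m = (x⁴;x⁴)_m`. It serves as the inner step for the series with base `x⁴`, which need a
second convolution. -/
theorem tsum_inv_qPoch_four_mul (hx : ‖x‖ < 1) :
    (∑' N : ℕ, x ^ N ^ 2 * (qPoch (x ^ 4) (x ^ 4) N)⁻¹) * qPochInf (-x ^ 2) (x ^ 2) = rrG x := by
  have hx2 := norm_sq_lt_one hx
  obtain ⟨M, hM⟩ := exists_norm_mul_inv_qPoch_le hx2 (f := fun _ => 1) (by simp)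
  have h := tsum_convolution hx 0 hx.le hM (C := fun N => (qPoch x x N)⁻¹) fun N => by
    have := sum_antidiagonal_of_mul_eq (eulerInv_eq_mul hx).symm N
    simpa only [coeff_rescale, eulerInv, coeff_mk, one_mul] using this
  rw [rrG, ← tsum_mul_right]
  simp only [zero_mul, add_zero] at h
  rw [← h]
  refine tsum_congr fun m => ?_
  have e : -(x ^ (2 * m + 1) * x) = -x ^ 2 * (x ^ 2) ^ m := by ring
  have hn : ‖-x ^ 2‖ < 1 := by rwa [norm_neg]
  rw [e, qPochInf_mul_pow hn hx2, show x ^ 4 = (x ^ 2) ^ 2 by ring, ← qPoch_mul_neg, mul_inv]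
  ring

/-- The same factorisation with the two factors exchanged, and `c = 1`. -/
theorem tsum_inv_qPoch_four_mul' (hx : ‖x‖ < 1) :
    (∑' N : ℕ, x ^ (N ^ 2 + 2 * N) * (qPoch (x ^ 4) (x ^ 4) N)⁻¹) * qPochInf (-x ^ 2) (x ^ 2) =
      rrH x := by
  have hx2 := norm_sq_lt_one hx
  obtain ⟨M, hM⟩ := exists_norm_mul_inv_qPoch_le hx2 (f := fun n => x ^ n) (norm_pow_le_one hx)
  have h := tsum_convolution hx 1 (s := 1) (by simp) hM (C := fun N => (qPoch x x N)⁻¹) fun N => by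
    have := sum_antidiagonal_of_mul_eq (((mul_comm _ _).trans (eulerInv_eq_mul hx).symm)) N
    simpa only [coeff_rescale, eulerInv, coeff_mk, one_mul, one_pow] using this
  rw [rrH, ← tsum_mul_right]
  simp only [one_mul, mul_one] at h
  rw [← h]
  refine tsum_congr fun m => ?_
  have e : -(x ^ (2 * m + 1 + 1)) = -x ^ 2 * (x ^ 2) ^ m := by ring
  have hn : ‖-x ^ 2‖ < 1 := by rwa [norm_neg]
  rw [e, qPochInf_mul_pow hn hx2, show x ^ 4 = (x ^ 2) ^ 2 by ring, ← qPoch_mul_neg, mul_inv]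
  ring

theorem qPochInf_neg_mul (hx : ‖x‖ < 1) :
    qPochInf (-x) (x ^ 2) * qPochInf (-x ^ 2) (x ^ 2) = qPochInf (-x) x := by
  rw [← qPochInf_mul_qPochInf_mul _ hx]
  ring_nf

theorem two_mul_choose_two_add (m : ℕ) : m ^ 2 = 2 * m.choose 2 + m := by
  rw [Nat.choose_two_right, Nat.mul_div_cancel' (Nat.even_mul_pred_self m).two_dvd]
  cases m with
  | zero => rfl
  | succ k => simp; ring

/-- Slater's identity (19), up to sign conventions. -/
theorem tsum_mul_qPochInf_neg_eq_rrG (hx : ‖x‖ < 1) :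
    (∑' m : ℕ, (-1) ^ m * x ^ (3 * m ^ 2) *
      (qPoch (-x) (x ^ 2) m * qPoch (x ^ 4) (x ^ 4) m)⁻¹) * qPochInf (-x) x = rrG x := by
  have hx2 := norm_sq_lt_one hx
  obtain ⟨M, hM⟩ := exists_norm_mul_inv_qPoch_le (norm_pow_lt_one' hx four_ne_zero)
    (f := fun m => (-1) ^ m * x ^ (2 * m ^ 2)) (fun n => by
      rw [norm_mul]; simpa using norm_pow_le_one hx (2 * n ^ 2))
  have h := tsum_convolution hx 0 (s := 1) (by simp) hM
    (C := fun N => (qPoch (x ^ 4) (x ^ 4) N)⁻¹) fun N => by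
    have := sum_antidiagonal_of_mul_eq (rescale_neg_eulerExp_sq_mul hx2) N
    simp only [coeff_rescale, eulerInv, eulerExp, coeff_mk, ← pow_mul] at this
    rw [← this]
    refine sum_congr rfl fun p _ => ?_
    rw [two_mul_choose_two_add p.1, neg_pow (x ^ 2)]
    ring
  rw [← tsum_inv_qPoch_four_mul hx, ← qPochInf_neg_mul hx, ← mul_assoc, ← tsum_mul_right]
  simp only [zero_mul, add_zero] at h
  rw [← h]
  congr 1
  refine tsum_congr fun m => ?_
  have e : -(x ^ (2 * m + 1) * 1) = -x * (x ^ 2) ^ m := by ring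
  rw [e, qPochInf_mul_pow (by rwa [norm_neg]) hx2, mul_inv]
  ring

/-- Slater's identity (15), up to sign conventions. -/
theorem tsum_mul_qPochInf_neg_eq_rrH (hx : ‖x‖ < 1) :
    (∑' m : ℕ, (-1) ^ m * x ^ (6 * m.choose 2 + m) *
      (qPoch (-x) (x ^ 2) m * qPoch (x ^ 4) (x ^ 4) m)⁻¹) * qPochInf (-x) x = rrH x := by
  have hx2 := norm_sq_lt_one hx
  obtain ⟨M, hM⟩ := exists_norm_mul_inv_qPoch_le (norm_pow_lt_one' hx four_ne_zero)
    (f := fun m => (-1) ^ m * x ^ (4 * m.choose 2)) (fun n => by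
      rw [norm_mul]; simpa using norm_pow_le_one hx (4 * n.choose 2))
  have h := tsum_convolution hx 0 (s := 1) (by simp) hM
    (C := fun N => x ^ (2 * N) * (qPoch (x ^ 4) (x ^ 4) N)⁻¹) fun N => by
    have := sum_antidiagonal_of_mul_eq (rescale_neg_one_eulerExp_sq_mul hx2) N
    simp only [coeff_rescale, eulerInv, eulerExp, coeff_mk, ← pow_mul] at this
    rw [← this]
    refine sum_congr rfl fun p _ => ?_
    ring
  rw [← tsum_inv_qPoch_four_mul' hx, ← qPochInf_neg_mul hx, ← mul_assoc, ← tsum_mul_right]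
  simp only [zero_mul, add_zero, ← mul_assoc, ← pow_add] at h
  rw [← h]
  congr 1
  refine tsum_congr fun m => ?_
  have e : -(x ^ (2 * m + 1) * 1) = -x * (x ^ 2) ^ m := by ring
  rw [e, qPochInf_mul_pow (by rwa [norm_neg]) hx2, mul_inv, two_mul_choose_two_add m]
  ring

/-- Taking `c = 2` in place of `c = 0` moves the Euler product one step along, which is why `m + 1`
appears in the denominator. -/
theorem tsum_succ_mul_qPochInf_neg_eq_rrH (hx : ‖x‖ < 1) :
    (∑' m : ℕ, (-1) ^ m * x ^ (3 * m ^ 2 + 2 * m) *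
      (qPoch (-x) (x ^ 2) (m + 1) * qPoch (x ^ 4) (x ^ 4) m)⁻¹) * qPochInf (-x) x = rrH x := by
  have hx2 := norm_sq_lt_one hx
  obtain ⟨M, hM⟩ := exists_norm_mul_inv_qPoch_le (norm_pow_lt_one' hx four_ne_zero)
    (f := fun m => (-1) ^ m * x ^ (2 * m ^ 2)) (fun n => by
      rw [norm_mul]; simpa using norm_pow_le_one hx (2 * n ^ 2))
  have h := tsum_convolution hx 2 (s := 1) (by simp) hM
    (C := fun N => (qPoch (x ^ 4) (x ^ 4) N)⁻¹) fun N => by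
    have := sum_antidiagonal_of_mul_eq (rescale_neg_eulerExp_sq_mul hx2) N
    simp only [coeff_rescale, eulerInv, eulerExp, coeff_mk, ← pow_mul] at this
    rw [← this]
    refine sum_congr rfl fun p _ => ?_
    rw [two_mul_choose_two_add p.1, neg_pow (x ^ 2)]
    ring
  rw [← tsum_inv_qPoch_four_mul' hx, ← qPochInf_neg_mul hx, ← mul_assoc, ← tsum_mul_right, ← h]
  congr 1
  refine tsum_congr fun m => ?_
  have e : -(x ^ (2 * m + 2 + 1) * 1) = -x * (x ^ 2) ^ (m + 1) := by ring
  rw [e, qPochInf_mul_pow (by rwa [norm_neg]) hx2, mul_inv]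
  ring

theorem exists_norm_choose_two_mul_inv_qPoch_le (hx : ‖x‖ < 1) :
    ∃ M, ∀ n, ‖x ^ n.choose 2 * (qPoch x x n)⁻¹‖ ≤ M :=
  exists_norm_mul_inv_qPoch_le hx fun n => norm_pow_le_one hx (n.choose 2)

theorem sum_antidiagonal_eulerExp_mul (hx : ‖x‖ < 1) (N : ℕ) :
    ∑ p ∈ antidiagonal N, x ^ p.1.choose 2 * (qPoch x x p.1)⁻¹ *
      ((-1) ^ p.2 * (qPoch (x ^ 2) (x ^ 2) p.2)⁻¹) = x ^ N ^ 2 * (qPoch (x ^ 2) (x ^ 2) N)⁻¹ := by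
  have := sum_antidiagonal_of_mul_eq (eulerExp_mul_rescale_neg_one hx) N
  simp only [coeff_rescale, eulerInv, eulerExp, coeff_mk, ← pow_mul] at this
  rw [this, two_mul_choose_two_add N]
  ring

/-- Slater's identity (46). -/
theorem tsum_mul_qPochInf_eq_rrG (hx : ‖x‖ < 1) :
    (∑' m : ℕ, x ^ (3 * m.choose 2 + m) * (qPoch x (x ^ 2) m * qPoch x x m)⁻¹) *
      qPochInf x (x ^ 2) = rrG (x ^ 2) := by
  have hx2 := norm_sq_lt_one hx
  obtain ⟨M, hM⟩ := exists_norm_choose_two_mul_inv_qPoch_le hx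
  have h := tsum_convolution hx 0 (s := -1) (by simp) hM (sum_antidiagonal_eulerExp_mul hx)
  rw [rrG, ← tsum_mul_right]
  simp only [← pow_mul, zero_mul, add_zero, ← mul_assoc, ← pow_add] at h ⊢
  simp only [← two_mul] at h
  rw [← h]
  refine tsum_congr fun m => ?_
  have e : -(x ^ (2 * m + 1) * -1) = x * (x ^ 2) ^ m := by ring
  rw [e, qPochInf_mul_pow hx hx2, mul_inv, two_mul_choose_two_add m]
  ring

/-- Slater's identity (44). -/
theorem tsum_mul_qPochInf_eq_rrH (hx : ‖x‖ < 1) :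
    (∑' m : ℕ, x ^ (3 * m.choose 2 + 3 * m) * (qPoch x (x ^ 2) (m + 1) * qPoch x x m)⁻¹) *
      qPochInf x (x ^ 2) = rrH (x ^ 2) := by
  have hx2 := norm_sq_lt_one hx
  obtain ⟨M, hM⟩ := exists_norm_choose_two_mul_inv_qPoch_le hx
  have h := tsum_convolution hx 2 (s := -1) (by simp) hM (sum_antidiagonal_eulerExp_mul hx)
  rw [rrH, ← tsum_mul_right]
  refine Eq.trans (tsum_congr fun m => ?_) (h.trans (tsum_congr fun m => ?_))
  · have e : -(x ^ (2 * m + 2 + 1) * -1) = x * (x ^ 2) ^ (m + 1) := by ring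
    rw [e, qPochInf_mul_pow hx hx2, mul_inv, two_mul_choose_two_add m]
    ring
  · ring

/-- Here `c = 1` and `s = -x`; the right side has exponent `(N² + N) + (N² - N) = 2N²`, which is
`rrG` at `x²`. -/
theorem tsum_succ_mul_qPochInf_eq_rrG (hx : ‖x‖ < 1) :
    (∑' m : ℕ, x ^ (3 * m.choose 2 + 2 * m) * (qPoch x (x ^ 2) (m + 1) * qPoch x x m)⁻¹) *
      qPochInf x (x ^ 2) = rrG (x ^ 2) := by
  have hx2 := norm_sq_lt_one hx
  obtain ⟨M, hM⟩ := exists_norm_choose_two_mul_inv_qPoch_le hx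
  have h := tsum_convolution hx 1 (s := -x) (by rw [norm_neg]; exact hx.le) hM
    (C := fun N => x ^ (2 * N.choose 2) * (qPoch (x ^ 2) (x ^ 2) N)⁻¹) fun N => by
    have := sum_antidiagonal_of_mul_eq (eulerExp_mul_rescale_neg hx) N
    simpa only [coeff_rescale, eulerInv, eulerExp, coeff_mk, ← pow_mul] using this
  rw [rrG, ← tsum_mul_right]
  refine Eq.trans (tsum_congr fun m => ?_) (h.trans (tsum_congr fun m => ?_))
  · have e : -(x ^ (2 * m + 1 + 1) * -x) = x * (x ^ 2) ^ (m + 1) := by ring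
    rw [e, qPochInf_mul_pow hx hx2, mul_inv, two_mul_choose_two_add m]
    ring
  · rw [two_mul_choose_two_add m]
    ring

end SingleSums

/-! ### Rogers–Ramanujan series as Selberg series -/

section RogersRamanujan

variable {q : ℂ}

theorem summable_choose_two_mul {c : ℕ → ℂ} {M : ℝ} (hc : ∀ n, ‖c n‖ ≤ M) (hq : ‖q‖ < 1)
    (y : ℂ) : Summable fun n : ℕ => q ^ n.choose 2 * y ^ n * c n := by
  refine Summable.of_norm_bounded
    ((summable_pow_choose_two_mul_pow (norm_nonneg q) hq ‖y‖).mul_right M) fun n => ?_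
  rw [norm_mul, norm_mul, norm_pow, norm_pow]
  exact mul_le_mul_of_nonneg_left (hc n) (by positivity)

/-- With `u k = max ‖D k‖ ‖D (k+1)‖` the recurrence gives `u k ≤ (1 + ‖q‖^k) u (k+1)`. Weighted by
the partial products of `1 + ‖q‖^i`, which converge, `u` is nondecreasing yet tends to 0. -/
theorem eq_zero_of_recurrence (hq : ‖q‖ < 1) {D : ℕ → ℂ}
    (h : ∀ k, D k = D (k + 1) + q ^ (k + 1) * D (k + 2)) (hD : Tendsto D atTop (𝓝 0)) (k : ℕ) :
    D k = 0 := by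
  set u : ℕ → ℝ := fun k => max ‖D k‖ ‖D (k + 1)‖ with hu
  have hu0 : ∀ k, 0 ≤ u k := fun k => (norm_nonneg _).trans (le_max_left _ _)
  have hstep : ∀ k, u k ≤ (1 + ‖q‖ ^ k) * u (k + 1) := by
    intro k
    have h1 : ‖D (k + 1)‖ ≤ u (k + 1) := le_max_left _ _
    have h2 : ‖D (k + 2)‖ ≤ u (k + 1) := le_max_right _ _
    have hp : 0 ≤ ‖q‖ ^ k * u (k + 1) := mul_nonneg (by positivity) (hu0 _)
    refine max_le ?_ (by linarith)
    rw [h k]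
    refine (norm_add_le _ _).trans ?_
    rw [norm_mul, norm_pow]
    have h3 : ‖q‖ ^ (k + 1) * ‖D (k + 2)‖ ≤ ‖q‖ ^ k * u (k + 1) :=
      mul_le_mul (pow_le_pow_of_le_one (norm_nonneg _) hq.le k.le_succ) h2 (norm_nonneg _)
        (by positivity)
    linarith
  have hut : Tendsto u atTop (𝓝 0) := by
    simpa using hD.norm.max ((tendsto_add_atTop_iff_nat 1).2 hD).norm
  have hmul : Multipliable fun k : ℕ => 1 + ‖q‖ ^ k :=
    Real.multipliable_one_add_of_summable (summable_geometric_of_lt_one (norm_nonneg q) hq)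
  have hpt := hmul.hasProd.tendsto_prod_nat.mul hut
  rw [mul_zero] at hpt
  have hle : ∀ k n, (∏ i ∈ Finset.range k, (1 + ‖q‖ ^ i)) * u k ≤
      (∏ i ∈ Finset.range (k + n), (1 + ‖q‖ ^ i)) * u (k + n) := by
    intro k n
    induction n with
    | zero => exact le_rfl
    | succ n ih =>
      refine ih.trans ?_
      rw [← add_assoc, Finset.prod_range_succ, mul_assoc]
      exact mul_le_mul_of_nonneg_left (hstep _) (Finset.prod_nonneg fun i _ => by positivity)
  have h0 : (∏ i ∈ Finset.range k, (1 + ‖q‖ ^ i)) * u k ≤ 0 := by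
    refine ge_of_tendsto hpt ?_
    filter_upwards [eventually_ge_atTop k] with n hn
    obtain ⟨m, rfl⟩ := Nat.exists_eq_add_of_le hn
    exact hle k m
  have hpos : 0 < ∏ i ∈ Finset.range k, (1 + ‖q‖ ^ i) :=
    Finset.prod_pos fun i _ => by positivity
  have hk : u k ≤ 0 := nonpos_of_mul_nonpos_right h0 hpos
  exact norm_le_zero_iff.1 ((le_max_left _ _).trans hk)

/-- The series `∑ q^{n² + kn} / (q;q)_n`. -/
noncomputable def rrSeries (q : ℂ) (k : ℕ) : ℂ := ∑' n : ℕ, q ^ (n ^ 2 + k * n) * (qPoch q q n)⁻¹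

theorem norm_rrSeries_term_le (hq : ‖q‖ < 1) {C : ℝ} (hC : ∀ n, ‖(qPoch q q n)⁻¹‖ ≤ C)
    (k n : ℕ) : ‖q ^ (n ^ 2 + k * n) * (qPoch q q n)⁻¹‖ ≤ ‖q‖ ^ n * C := by
  rw [norm_mul, norm_pow]
  exact mul_le_mul (pow_le_pow_of_le_one (norm_nonneg _) hq.le
    ((Nat.le_self_pow two_ne_zero n).trans (Nat.le_add_right _ _))) (hC n) (norm_nonneg _)
    (by positivity)

theorem summable_rrSeries (hq : ‖q‖ < 1) (k : ℕ) :
    Summable fun n : ℕ => q ^ (n ^ 2 + k * n) * (qPoch q q n)⁻¹ := by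
  obtain ⟨C, -, hC⟩ := exists_norm_inv_qPoch_le hq hq
  exact Summable.of_norm_bounded ((summable_geometric_of_lt_one (norm_nonneg q) hq).mul_right C)
    (norm_rrSeries_term_le hq hC k)

theorem rrSeries_recurrence (hq : ‖q‖ < 1) (k : ℕ) :
    rrSeries q k = rrSeries q (k + 1) + q ^ (k + 1) * rrSeries q (k + 2) := by
  have h0 := summable_rrSeries hq k
  have h1 := summable_rrSeries hq (k + 1)
  rw [← sub_eq_iff_eq_add', rrSeries, rrSeries, rrSeries, ← h0.tsum_sub h1, ← tsum_mul_left,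
    (h0.sub h1).tsum_eq_zero_add]
  simp only [mul_zero, sub_self, zero_add]
  refine tsum_congr fun n => ?_
  rw [← inv_qPoch_succ hq n]
  ring

theorem tendsto_rrSeries (hq : ‖q‖ < 1) : Tendsto (rrSeries q) atTop (𝓝 1) := by
  obtain ⟨C, -, hC⟩ := exists_norm_inv_qPoch_le hq hq
  have h1 : ∑' n : ℕ, (if n = 0 then (1 : ℂ) else 0) = 1 := by simp
  rw [← h1]
  refine tendsto_tsum_of_dominated_convergence
    ((summable_geometric_of_lt_one (norm_nonneg q) hq).mul_right C) ?_
    (Eventually.of_forall fun k n => norm_rrSeries_term_le hq hC k n)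
  intro n
  rcases eq_or_ne n 0 with rfl | hn
  · simp [qPoch]
  · have h := (tendsto_pow_atTop_nhds_zero_of_norm_lt_one hq).comp
      (tendsto_id.atTop_mul_const' (r := n) (Nat.pos_of_ne_zero hn))
    have h2 := (h.const_mul (q ^ n ^ 2)).mul_const (qPoch q q n)⁻¹
    simpa [hn, pow_add] using h2

/-- Selberg's alternating series `H₁`. -/
noncomputable def selbergOne (q a : ℂ) : ℂ :=
  ∑' n : ℕ, (q ^ 5) ^ n.choose 2 * (-(a ^ 2 * q ^ 2)) ^ n *
    ((1 - a * q ^ (2 * n)) * (qPoch a q n * (qPoch q q n)⁻¹))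

/-- Selberg's alternating series `H₂`. -/
noncomputable def selbergTwo (q a : ℂ) : ℂ :=
  ∑' n : ℕ, (q ^ 5) ^ n.choose 2 * (-(a ^ 2 * q)) ^ n *
    ((1 - a ^ 2 * q ^ (4 * n)) * (qPoch a q n * (qPoch q q n)⁻¹))

theorem qPoch_ratio_succ (hq : ‖q‖ < 1) (a : ℂ) (n : ℕ) :
    qPoch a q (n + 1) * (qPoch q q (n + 1))⁻¹ * (1 - q ^ (n + 1)) =
      (1 - a) * (qPoch (a * q) q n * (qPoch q q n)⁻¹) := by
  rw [mul_assoc, inv_qPoch_succ hq, qPoch_succ', mul_assoc]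

theorem qPoch_ratio_mul (a : ℂ) (n : ℕ) :
    qPoch a q n * (qPoch q q n)⁻¹ * (1 - a * q ^ n) =
      (1 - a) * (qPoch (a * q) q n * (qPoch q q n)⁻¹) := by
  rw [mul_right_comm, ← qPoch_succ, qPoch_succ', mul_assoc]

theorem exists_norm_qPoch_ratio_le (hq : ‖q‖ < 1) (a : ℂ) :
    ∃ M, ∀ n, ‖qPoch a q n * (qPoch q q n)⁻¹‖ ≤ M := by
  obtain ⟨C, hC⟩ := exists_norm_qPoch_le a hq
  obtain ⟨D, hD0, hD⟩ := exists_norm_inv_qPoch_le hq hq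
  refine ⟨C * D, fun n => ?_⟩
  rw [norm_mul]
  exact mul_le_mul (hC n) (hD n) (norm_nonneg _) ((norm_nonneg _).trans (hC 0))

/-- Regrouping `∑ f`, where `f n` is the sum of `g n` and the shifted term `k (n - 1)`. -/
theorem tsum_eq_tsum_of_shift {f g k s : ℕ → ℂ} (hg : Summable g) (hk : Summable k)
    (h0 : f 0 = g 0) (hf : ∀ n, f (n + 1) = g (n + 1) + k n) (hs : ∀ n, s n = g n + k n) :
    ∑' n, f n = ∑' n, s n := by
  have hg' := (summable_nat_add_iff 1).2 hg
  have hf1 : Summable fun n => f (n + 1) := by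
    simpa only [hf] using hg'.add hk
  have hfs : Summable f := (summable_nat_add_iff 1).1 hf1
  rw [hfs.tsum_eq_zero_add, h0, tsum_congr hs, hg.tsum_add hk, hg.tsum_eq_zero_add, tsum_congr hf,
    hg'.tsum_add hk, add_assoc]

/-- Write `1 - a q^{2n} = (1 - q^n) + q^n (1 - a q^n)`. The first part cancels against `(q;q)_n` and
shifts the index, the second extends `(a;q)_n`; both produce `(1 - a)(aq;q)_n`. -/
theorem selbergOne_eq (hq : ‖q‖ < 1) (a : ℂ) :
    selbergOne q a = (1 - a) * selbergTwo q (a * q) := by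
  obtain ⟨M, hM⟩ := exists_norm_qPoch_ratio_le hq (a * q)
  have hq5 := norm_pow_lt_one' hq (n := 5) (by norm_num)
  rw [selbergOne, selbergTwo, ← tsum_mul_left]
  refine tsum_eq_tsum_of_shift
    ((summable_choose_two_mul hM hq5 (-(a ^ 2 * q ^ 3))).mul_left (1 - a))
    ((summable_choose_two_mul hM hq5 (-(a ^ 2 * q ^ 7))).mul_left (-(a ^ 2 * q ^ 2) * (1 - a)))
    ?_ ?_ ?_
  · simp [qPoch]
  · intro n
    have h1 := qPoch_ratio_succ hq a n
    have h2 := qPoch_ratio_mul (q := q) a (n + 1)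
    rw [choose_two_succ]
    linear_combination ((q ^ 5) ^ (n + n.choose 2) * (-(a ^ 2 * q ^ 2)) ^ (n + 1)) * h1 +
      ((q ^ 5) ^ (n + n.choose 2) * (-(a ^ 2 * q ^ 3)) ^ (n + 1)) * h2
  · intro n
    ring

/-- The same device applied to the difference, using `1 - a² q^{4n} - q^n (1 - a q^{2n}) = (1 - q^n)
+ a q^{3n} (1 - a q^n)`. -/
theorem selbergTwo_eq (hq : ‖q‖ < 1) (a : ℂ) :
    selbergTwo q a = selbergOne q a + a * (1 - a) * selbergOne q (a * q) := by
  obtain ⟨M, hM⟩ := exists_norm_qPoch_ratio_le hq (a * q)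
  obtain ⟨M', hM'⟩ := exists_norm_qPoch_ratio_le hq a
  have hq5 := norm_pow_lt_one' hq (n := 5) (by norm_num)
  have s1 : Summable fun n : ℕ => (q ^ 5) ^ n.choose 2 * (-(a ^ 2 * q ^ 2)) ^ n *
      ((1 - a * q ^ (2 * n)) * (qPoch a q n * (qPoch q q n)⁻¹)) := by
    refine ((summable_choose_two_mul hM' hq5 (-(a ^ 2 * q ^ 2))).sub
      ((summable_choose_two_mul hM' hq5 (-(a ^ 2 * q ^ 4))).mul_left a)).congr fun n => ?_
    ring
  have s2 : Summable fun n : ℕ => (q ^ 5) ^ n.choose 2 * (-(a ^ 2 * q)) ^ n *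
      ((1 - a ^ 2 * q ^ (4 * n)) * (qPoch a q n * (qPoch q q n)⁻¹)) := by
    refine ((summable_choose_two_mul hM' hq5 (-(a ^ 2 * q))).sub
      ((summable_choose_two_mul hM' hq5 (-(a ^ 2 * q ^ 5))).mul_left (a ^ 2))).congr fun n => ?_
    ring
  rw [← sub_eq_iff_eq_add', selbergTwo, selbergOne, ← s2.tsum_sub s1, selbergOne, ← tsum_mul_left]
  refine tsum_eq_tsum_of_shift
    ((summable_choose_two_mul hM hq5 (-(a ^ 2 * q ^ 4))).mul_left (a * (1 - a)))
    ((summable_choose_two_mul hM hq5 (-(a ^ 2 * q ^ 6))).mul_left (-(a ^ 2 * q) * (1 - a)))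
    ?_ ?_ ?_
  · simp [qPoch]
    ring
  · intro n
    have h1 := qPoch_ratio_succ hq a n
    have h2 := qPoch_ratio_mul (q := q) a (n + 1)
    rw [choose_two_succ]
    linear_combination ((q ^ 5) ^ (n + n.choose 2) * (-(a ^ 2 * q)) ^ (n + 1)) * h1 +
      (a * (q ^ 5) ^ (n + n.choose 2) * (-(a ^ 2 * q ^ 4)) ^ (n + 1)) * h2
  · intro n
    ring

theorem selbergTwo_recurrence (hq : ‖q‖ < 1) {a : ℂ} (ha : ‖a‖ < 1) :
    selbergTwo q a / qPochInf a q = selbergTwo q (a * q) / qPochInf (a * q) q +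
      a * (selbergTwo q (a * q ^ 2) / qPochInf (a * q ^ 2) q) := by
  have haq : ‖a * q‖ < 1 := by simpa using norm_mul_pow_lt_one ha hq 1
  have h1 := one_sub_ne_zero_of_norm_lt ha
  have h2 := one_sub_ne_zero_of_norm_lt haq
  have h3 := qPochInf_ne_zero_of_norm_lt (norm_mul_pow_lt_one ha hq 2) hq
  rw [selbergTwo_eq hq, selbergOne_eq hq a, selbergOne_eq hq (a * q),
    qPochInf_eq_one_sub_mul a hq, qPochInf_eq_one_sub_mul (a * q) hq, mul_assoc a q q, ← sq]
  field_simp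

theorem tendsto_selbergTwo (hq : ‖q‖ < 1) :
    Tendsto (fun k : ℕ => selbergTwo q (q ^ (k + 1))) atTop (𝓝 1) := by
  obtain ⟨C, hC⟩ := exists_norm_qPoch_le q hq
  obtain ⟨D, hD0, hD⟩ := exists_norm_inv_qPoch_le hq hq
  have hC0 : 0 ≤ C := (norm_nonneg _).trans (hC 0)
  have hq5 := norm_pow_lt_one' hq (n := 5) (by norm_num)
  have h1 : ∑' n : ℕ, (if n = 0 then (1 : ℂ) else 0) = 1 := by simp
  rw [← h1]
  have hp := (tendsto_add_atTop_iff_nat 1).2 (tendsto_pow_atTop_nhds_zero_of_norm_lt_one hq)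
  refine tendsto_tsum_of_dominated_convergence ((summable_pow_choose_two_mul_pow
    (norm_nonneg _) hq5 1).mul_right (2 * (C * D * D))) ?_ (Eventually.of_forall fun k n => ?_)
  · intro n
    have hcont : Continuous fun a : ℂ => (q ^ 5) ^ n.choose 2 * (-(a ^ 2 * q)) ^ n *
        ((1 - a ^ 2 * q ^ (4 * n)) * (qPoch a q n * (qPoch q q n)⁻¹)) := by
      unfold qPoch
      fun_prop
    have := (hcont.tendsto 0).comp hp
    rcases eq_or_ne n 0 with rfl | hn
    · simpa [Function.comp_def, qPoch] using this
    · simpa [Function.comp_def, hn] using this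
  -- This quotient bounds `(q^{k+1};q)_n` uniformly in `k`, as dominated convergence requires.
  · have hr : qPoch (q ^ (k + 1)) q n = qPoch q q (k + n) * (qPoch q q k)⁻¹ := by
      rw [eq_mul_inv_iff_mul_eq₀ (qPoch_ne_zero_of_norm_lt hq hq k), mul_comm, qPoch, qPoch, qPoch,
        Finset.prod_range_add]
      congr 1
      exact Finset.prod_congr rfl fun i _ => by ring
    have e1 : ‖(-((q ^ (k + 1)) ^ 2 * q)) ^ n‖ ≤ 1 ^ n := by
      rw [norm_pow, norm_neg, ← pow_mul, ← pow_succ]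
      exact pow_le_pow_left₀ (norm_nonneg _) (norm_pow_le_one hq _) n
    have e2 : ‖1 - (q ^ (k + 1)) ^ 2 * q ^ (4 * n)‖ ≤ 2 := by
      refine (norm_sub_le _ _).trans ?_
      rw [norm_one, ← pow_mul, ← pow_add]
      linarith [norm_pow_le_one hq ((k + 1) * 2 + 4 * n)]
    have e3 : ‖qPoch (q ^ (k + 1)) q n * (qPoch q q n)⁻¹‖ ≤ C * D * D := by
      rw [hr, norm_mul, norm_mul]
      have a1 := hC (k + n)
      have a2 := hD k
      have a3 := hD n
      gcongr
    rw [norm_mul, norm_mul, norm_mul, norm_pow (q ^ 5)]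
    gcongr

theorem tendsto_qPochInf_pow (hq : ‖q‖ < 1) :
    Tendsto (fun k : ℕ => qPochInf (q ^ (k + 1)) q) atTop (𝓝 1) := by
  have h0 := qPochInf_ne_zero_of_norm_lt hq hq
  have h := ((tendsto_qPoch q hq).inv₀ h0).const_mul (qPochInf q q)
  rw [mul_inv_cancel₀ h0] at h
  refine h.congr fun k => ?_
  rw [pow_succ', qPochInf_mul_pow hq hq]

theorem rrSeries_eq_selbergTwo (hq : ‖q‖ < 1) (k : ℕ) :
    rrSeries q k = selbergTwo q (q ^ (k + 1)) / qPochInf (q ^ (k + 1)) q := by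
  rw [← sub_eq_zero]
  refine eq_zero_of_recurrence (D := fun k => rrSeries q k -
    selbergTwo q (q ^ (k + 1)) / qPochInf (q ^ (k + 1)) q) hq (fun k => ?_) ?_ k
  · have h1 := rrSeries_recurrence hq k
    have h2 := selbergTwo_recurrence hq (norm_pow_lt_one' hq k.succ_ne_zero)
    rw [← pow_succ, ← pow_add, Nat.succ_eq_add_one] at h2
    rw [h1, h2]
    ring
  · simpa using (tendsto_rrSeries hq).sub
      ((tendsto_selbergTwo hq).div (tendsto_qPochInf_pow hq) one_ne_zero)

theorem rrG_mul_qPochInf (hq : ‖q‖ < 1) : rrG q * qPochInf q q = selbergTwo q q := by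
  have h := rrSeries_eq_selbergTwo hq 0
  rw [zero_add, pow_one, eq_div_iff (qPochInf_ne_zero_of_norm_lt hq hq)] at h
  rw [← h, rrG, rrSeries]
  simp

theorem rrH_mul_qPochInf (hq : ‖q‖ < 1) : rrH q * qPochInf q q = selbergOne q q := by
  have h := rrSeries_eq_selbergTwo hq 1
  have h1 := norm_pow_lt_one' hq (n := 1 + 1) (by norm_num)
  rw [eq_div_iff (qPochInf_ne_zero_of_norm_lt h1 hq), one_add_one_eq_two, sq] at h
  rw [selbergOne_eq hq, ← h, qPochInf_eq_one_sub_mul q hq, rrH, rrSeries]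
  simp only [one_mul]
  ring

end RogersRamanujan

/-! ### Jacobi triple product and the theta form of Selberg's series -/

section TripleProduct

variable {q z : ℂ}

/-- Euler's first identity. -/
theorem tsum_pow_mul_inv_qPoch (hq : ‖q‖ < 1) (hz : ‖z‖ < 1) :
    (∑' n : ℕ, z ^ n * (qPoch q q n)⁻¹) * qPochInf z q = 1 := by
  have h1 : Summable fun n : ℕ => ‖z ^ n * (qPoch q q n)⁻¹‖ := by
    obtain ⟨C, -, hC⟩ := exists_norm_inv_qPoch_le hq hq
    refine Summable.of_nonneg_of_le (fun _ => norm_nonneg _) (fun n => ?_)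
      ((summable_geometric_of_lt_one (norm_nonneg z) hz).mul_right C)
    rw [norm_mul, norm_pow]
    exact mul_le_mul_of_nonneg_left (hC n) (by positivity)
  have h2 := summable_norm_euler hq (-z)
  have h3 := tsum_euler hq (-z)
  rw [neg_neg] at h3
  rw [← h3, mul_comm, tsum_mul_tsum_eq_tsum_sum_antidiagonal_of_summable_norm h2 h1]
  have key : ∀ N, ∑ p ∈ Finset.HasAntidiagonal.antidiagonal N, q ^ p.1.choose 2 * (-z) ^ p.1 / qPoch q q p.1 *
      (z ^ p.2 * (qPoch q q p.2)⁻¹) = if N = 0 then 1 else 0 := by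
    intro N
    have := sum_antidiagonal_of_mul_eq (rescale_neg_eulerExp_mul hq z) N
    simp only [PowerSeries.coeff_rescale, eulerInv, eulerExp, PowerSeries.coeff_mk,
      PowerSeries.coeff_one] at this
    rw [← this]
    exact Finset.sum_congr rfl fun p _ => by rw [div_eq_mul_inv]; ring
  simp [key]

theorem qPochInf_eq_zero {a : ℂ} (hq : ‖q‖ < 1) {n : ℕ} (h : a * q ^ n = 1) :
    qPochInf a q = 0 := by
  rw [qPochInf_eq_qPoch_mul a hq (n + 1), qPoch_succ, h]
  simp

/-- The exponent `n (n - 1) / 2` for an integer `n`. -/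
@[irreducible] def triangle (n : ℤ) : ℤ := n * (n - 1) / 2

theorem two_mul_triangle (n : ℤ) : 2 * triangle n = n * (n - 1) := by
  rw [triangle]
  exact Int.mul_ediv_cancel' (Int.even_mul_pred_self n).two_dvd

theorem triangle_natCast (n : ℕ) : triangle n = (n.choose 2 : ℕ) := by
  have h1 := two_mul_triangle n
  have h2 : ((n ^ 2 : ℕ) : ℤ) = ((2 * n.choose 2 + n : ℕ) : ℤ) :=
    congrArg Nat.cast (two_mul_choose_two_add n)
  push_cast at h2
  linarith

theorem triangle_neg_succ (n : ℕ) : triangle (-((n : ℤ) + 1)) = ((n + 2).choose 2 : ℕ) := by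
  rw [← triangle_natCast]
  have h1 := two_mul_triangle (-((n : ℤ) + 1))
  have h2 := two_mul_triangle ((n + 2 : ℕ) : ℤ)
  push_cast at h2 ⊢
  linarith

theorem hasSum_theta (hq : ‖q‖ < 1) (z : ℂ) :
    Summable (fun N : ℤ => q ^ triangle N * z ^ N) ∧
    ∑' N : ℤ, q ^ triangle N * z ^ N = ∑' n : ℕ, q ^ n.choose 2 * z ^ n +
      ∑' n : ℕ, q ^ (n + 2).choose 2 * z⁻¹ ^ (n + 1) := by
  have hs : ∀ y : ℂ, Summable fun n : ℕ => q ^ n.choose 2 * y ^ n := fun y => by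
    simpa using summable_choose_two_mul (c := fun _ => 1) (M := 1) (by simp) hq y
  have h1 : Summable fun n : ℕ => q ^ triangle (n : ℤ) * z ^ (n : ℤ) := by
    simpa only [triangle_natCast, zpow_natCast] using hs z
  have e2 : (fun n : ℕ => q ^ triangle (-((n : ℤ) + 1)) * z ^ (-((n : ℤ) + 1))) =
      fun n : ℕ => q ^ (n + 2).choose 2 * z⁻¹ ^ (n + 1) := by
    ext n
    rw [triangle_neg_succ, zpow_natCast, zpow_neg, ← inv_zpow]
    norm_cast
  have h2 : Summable fun n : ℕ => q ^ triangle (-((n : ℤ) + 1)) * z ^ (-((n : ℤ) + 1)) := by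
    rw [e2]
    refine ((hs (q ^ 2 * z⁻¹)).mul_left (q * z⁻¹)).congr fun n => ?_
    rw [choose_two_succ, choose_two_succ]
    ring
  refine ⟨Summable.of_nat_of_neg_add_one (f := fun N : ℤ => q ^ triangle N * z ^ N) h1 h2, ?_⟩
  have h := tsum_of_nat_of_neg_add_one (f := fun N : ℤ => q ^ triangle N * z ^ N) h1 h2
  simp only [triangle_natCast, zpow_natCast, congrFun e2] at h
  exact h

/-- The **Jacobi triple product** in the annulus `‖q‖ < ‖z‖`. -/
theorem jacobi_triple_product (hq0 : q ≠ 0) (hq : ‖q‖ < 1) (hz : ‖q‖ < ‖z‖) :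
    ∑' n : ℕ, q ^ n.choose 2 * z ^ n + ∑' n : ℕ, q ^ (n + 2).choose 2 * z⁻¹ ^ (n + 1) =
      qPochInf (-z) q * qPochInf (-(q / z)) q * qPochInf q q := by
  have hz0 : z ≠ 0 := by
    rintro rfl
    rw [norm_zero] at hz
    exact absurd hz (not_lt.2 (norm_nonneg _))
  obtain ⟨hs, heq⟩ := hasSum_theta hq z
  rw [← heq]
  have hw : ‖-(q / z)‖ < 1 := by
    rw [norm_neg, norm_div]
    exact (div_lt_one ((norm_nonneg _).trans_lt hz)).2 hz
  obtain ⟨C, hC0, hC⟩ := exists_norm_inv_qPoch_le hq hq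
  have hb : Summable fun m : ℕ => (-(q / z)) ^ m * (qPoch q q m)⁻¹ := by
    refine Summable.of_norm_bounded
      ((summable_geometric_of_lt_one (norm_nonneg _) hw).mul_right C) fun n => ?_
    rw [norm_mul, norm_pow]
    exact mul_le_mul_of_nonneg_left (hC n) (by positivity)
  have hprod : Summable fun p : ℤ × ℕ => q ^ triangle p.1 * z ^ p.1 *
      ((-(q / z)) ^ p.2 * (qPoch q q p.2)⁻¹) :=
    summable_mul_of_summable_norm (f := fun N : ℤ => q ^ triangle N * z ^ N)
      (g := fun m : ℕ => (-(q / z)) ^ m * (qPoch q q m)⁻¹) hs.norm hb.norm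
  -- The theta series is multiplied by the expansion of `1/(-q/z;q)_∞` and regrouped by `n = N - m`;
  -- the sum over `m` is then Euler's series for `(q^{n+1};q)_∞`.
  let e : ℤ × ℕ ≃ ℤ × ℕ :=
    { toFun := fun p => (p.1 + p.2, p.2)
      invFun := fun p => (p.1 - p.2, p.2)
      left_inv := fun p => by simp
      right_inv := fun p => by simp }
  have hterm : ∀ (n : ℤ) (m : ℕ), q ^ triangle (n + m) * z ^ (n + m) *
      ((-(q / z)) ^ m * (qPoch q q m)⁻¹) =
      q ^ triangle n * z ^ n * (q ^ m.choose 2 * (-(q ^ (n + 1))) ^ m / qPoch q q m) := by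
    intro n m
    have ht : triangle (n + m) + m = triangle n + (m.choose 2 : ℕ) + (n + 1) * m := by
      rw [← triangle_natCast]
      have h1 := two_mul_triangle (n + m)
      have h2 := two_mul_triangle n
      have h3 := two_mul_triangle m
      linarith
    have hq' : q ^ triangle (n + m) * q ^ m = q ^ triangle n * q ^ m.choose 2 * (q ^ (n + 1)) ^ m := by
      rw [← zpow_natCast q m, ← zpow_natCast q (m.choose 2), ← zpow_natCast (q ^ (n + 1)) m,
        ← zpow_mul, ← zpow_add₀ hq0, ← zpow_add₀ hq0, ← zpow_add₀ hq0, ht]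
    rw [neg_pow (q / z), neg_pow (q ^ (n + 1)), div_pow, zpow_add₀ hz0, zpow_natCast]
    have hzm : z ^ m ≠ 0 := pow_ne_zero _ hz0
    calc _ = (q ^ triangle (n + m) * q ^ m) * z ^ n * (z ^ m / z ^ m) * (-1) ^ m *
          (qPoch q q m)⁻¹ := by ring
      _ = _ := by rw [hq', div_self hzm]; ring
  have hL : ∑' p : ℤ × ℕ, q ^ triangle p.1 * z ^ p.1 * ((-(q / z)) ^ p.2 * (qPoch q q p.2)⁻¹) =
      qPochInf (-z) q * qPochInf q q := by
    have hse := (e.summable_iff (f := fun p : ℤ × ℕ => q ^ triangle p.1 * z ^ p.1 *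
      ((-(q / z)) ^ p.2 * (qPoch q q p.2)⁻¹))).2 hprod
    rw [← e.tsum_eq]
    have hse' : Summable fun p : ℤ × ℕ => q ^ triangle (e p).1 * z ^ (e p).1 *
      ((-(q / z)) ^ (e p).2 * (qPoch q q (e p).2)⁻¹) := hse
    rw [hse'.tsum_prod]
    have inner : ∀ n : ℤ, ∑' m : ℕ, q ^ triangle (e (n, m)).1 * z ^ (e (n, m)).1 *
        ((-(q / z)) ^ (e (n, m)).2 * (qPoch q q (e (n, m)).2)⁻¹) =
        q ^ triangle n * z ^ n * qPochInf (q ^ (n + 1)) q := by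
      intro n
      rw [← neg_neg (q ^ (n + 1)), ← tsum_euler hq, ← tsum_mul_left]
      exact tsum_congr fun m => hterm n m
    rw [tsum_congr inner]
    -- For negative index the product contains the factor `1 - q^0`. The nonnegative indices form
    -- Euler's series for `(-z;q)_∞`.
    have hneg : ∀ n : ℕ, q ^ triangle (-((n : ℤ) + 1)) * z ^ (-((n : ℤ) + 1)) *
        qPochInf (q ^ (-((n : ℤ) + 1) + 1)) q = 0 := by
      intro n
      rw [qPochInf_eq_zero hq (n := n), mul_zero]
      rw [← zpow_natCast, ← zpow_add₀ hq0]
      simp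
    have hnat : ∀ n : ℕ, q ^ triangle (n : ℤ) * z ^ (n : ℤ) * qPochInf (q ^ ((n : ℤ) + 1)) q =
        q ^ n.choose 2 * z ^ n / qPoch q q n * qPochInf q q := by
      intro n
      have : q ^ ((n : ℤ) + 1) = q * q ^ n := by
        rw [← pow_succ']
        exact_mod_cast rfl
      rw [this, qPochInf_mul_pow hq hq, triangle_natCast, zpow_natCast, zpow_natCast]
      ring
    have hfin := tsum_of_nat_of_neg_add_one
      (f := fun n : ℤ => q ^ triangle n * z ^ n * qPochInf (q ^ (n + 1)) q)
      (((summable_norm_euler hq z).of_norm.mul_right _).congr fun n => (hnat n).symm)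
      (summable_zero.congr fun n => (hneg n).symm)
    rw [hfin, tsum_congr hneg, tsum_congr hnat, tsum_zero, add_zero, tsum_mul_right, tsum_euler hq]
  rw [← tsum_mul_tsum_of_summable_norm hs.norm hb.norm] at hL
  have h1 := tsum_pow_mul_inv_qPoch hq hw
  linear_combination qPochInf (-(q / z)) q * hL -
    (∑' N : ℤ, q ^ triangle N * z ^ N) * h1

/-- At `a = q` the ratio `(a;q)_n/(q;q)_n` is 1, and the two terms of `1 - q^{4n+2}` are the two
halves of the theta series with base `q⁵` and `z = -q³`. -/
theorem selbergTwo_self (hq0 : q ≠ 0) (hq : ‖q‖ < 1) :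
    selbergTwo q q = qPochInf (q ^ 3) (q ^ 5) * qPochInf (q ^ 2) (q ^ 5) *
      qPochInf (q ^ 5) (q ^ 5) := by
  have hq5 := norm_pow_lt_one' hq (n := 5) (by norm_num)
  have hlt : ‖q ^ 5‖ < ‖-q ^ 3‖ := by
    rw [norm_neg, norm_pow, norm_pow]
    exact pow_lt_pow_right_of_lt_one₀ (norm_pos_iff.2 hq0) hq (by norm_num)
  have h := jacobi_triple_product (pow_ne_zero 5 hq0) hq5 hlt
  have e1 : -(q ^ 5 / -q ^ 3) = q ^ 2 := by field_simp
  rw [neg_neg, e1] at h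
  rw [← h]
  have hs : ∀ y : ℂ, Summable fun n : ℕ => (q ^ 5) ^ n.choose 2 * y ^ n := fun y => by
    simpa using summable_choose_two_mul (c := fun _ => 1) (M := 1) (by simp) hq5 y
  have e2 : ∀ n : ℕ, (q ^ 5) ^ (n + 2).choose 2 * (-q ^ 3)⁻¹ ^ (n + 1) =
      -q ^ 2 * ((q ^ 5) ^ n.choose 2 * (-q ^ 7) ^ n) := by
    intro n
    rw [choose_two_succ, choose_two_succ, inv_pow, ← div_eq_mul_inv, div_eq_iff (by simp [hq0])]
    rw [neg_pow (q ^ 7), neg_pow (q ^ 3) (n + 1)]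
    have : ((-1 : ℂ) ^ n) * (-1) ^ n = 1 := by rw [← mul_pow]; simp
    linear_combination (-(q ^ 5) ^ (n + 1 + (n + n.choose 2))) * this
  simp only [e2]
  rw [← ((hs _).tsum_add ((hs _).mul_left _))]
  refine tsum_congr fun n => ?_
  rw [mul_inv_cancel₀ (qPoch_ne_zero_of_norm_lt hq hq n)]
  ring

theorem selbergOne_self (hq0 : q ≠ 0) (hq : ‖q‖ < 1) :
    selbergOne q q = qPochInf (q ^ 4) (q ^ 5) * qPochInf q (q ^ 5) *
      qPochInf (q ^ 5) (q ^ 5) := by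
  have hq5 := norm_pow_lt_one' hq (n := 5) (by norm_num)
  have hlt : ‖q ^ 5‖ < ‖-q ^ 4‖ := by
    rw [norm_neg, norm_pow, norm_pow]
    exact pow_lt_pow_right_of_lt_one₀ (norm_pos_iff.2 hq0) hq (by norm_num)
  have h := jacobi_triple_product (pow_ne_zero 5 hq0) hq5 hlt
  have e1 : -(q ^ 5 / -q ^ 4) = q := by field_simp
  rw [neg_neg, e1] at h
  rw [← h]
  have hs : ∀ y : ℂ, Summable fun n : ℕ => (q ^ 5) ^ n.choose 2 * y ^ n := fun y => by
    simpa using summable_choose_two_mul (c := fun _ => 1) (M := 1) (by simp) hq5 y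
  have e2 : ∀ n : ℕ, (q ^ 5) ^ (n + 2).choose 2 * (-q ^ 4)⁻¹ ^ (n + 1) =
      -q * ((q ^ 5) ^ n.choose 2 * (-q ^ 6) ^ n) := by
    intro n
    rw [choose_two_succ, choose_two_succ, inv_pow, ← div_eq_mul_inv, div_eq_iff (by simp [hq0])]
    rw [neg_pow (q ^ 6), neg_pow (q ^ 4) (n + 1)]
    have : ((-1 : ℂ) ^ n) * (-1) ^ n = 1 := by rw [← mul_pow]; simp
    linear_combination (-(q ^ 5) ^ (n + 1 + (n + n.choose 2))) * this
  simp only [e2]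
  rw [← ((hs _).tsum_add ((hs _).mul_left _))]
  refine tsum_congr fun n => ?_
  rw [mul_inv_cancel₀ (qPoch_ne_zero_of_norm_lt hq hq n)]
  ring

end TripleProduct

/-! ### Product manipulations for `J_m` and `J_{a,m}` -/

section Products

variable {q : ℂ}

theorem qPochInf_mul_neg (a : ℂ) (hq : ‖q‖ < 1) :
    qPochInf a q * qPochInf (-a) q = qPochInf (a ^ 2) (q ^ 2) :=
  tendsto_nhds_unique (((tendsto_qPoch a hq).mul (tendsto_qPoch (-a) hq)).congr
    fun n => qPoch_mul_neg a q n) (tendsto_qPoch (a ^ 2) (norm_sq_lt_one hq))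

theorem qPochInf_eq_prod_five (a : ℂ) (hq : ‖q‖ < 1) :
    qPochInf a q = qPochInf a (q ^ 5) * qPochInf (a * q) (q ^ 5) * qPochInf (a * q ^ 2) (q ^ 5) *
      qPochInf (a * q ^ 3) (q ^ 5) * qPochInf (a * q ^ 4) (q ^ 5) := by
  have hq5 := norm_pow_lt_one' hq (n := 5) (by norm_num)
  have h := (tendsto_qPoch a hq).comp (tendsto_id.const_mul_atTop' (r := 5) (by norm_num))
  refine tendsto_nhds_unique h (((((tendsto_qPoch a hq5).mul (tendsto_qPoch (a * q) hq5)).mul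
    (tendsto_qPoch (a * q ^ 2) hq5)).mul (tendsto_qPoch (a * q ^ 3) hq5)).mul
    (tendsto_qPoch (a * q ^ 4) hq5) |>.congr fun n => ?_)
  simp only [Function.comp, id]
  induction n with
  | zero => simp [qPoch]
  | succ n ih =>
    rw [show 5 * (n + 1) = 5 * n + 1 + 1 + 1 + 1 + 1 from rfl]
    simp only [qPoch_succ]
    rw [← ih]
    ring

/-- The **first Rogers–Ramanujan identity**. -/
theorem rrG_mul (hq0 : q ≠ 0) (hq : ‖q‖ < 1) :
    rrG q * (qPochInf q (q ^ 5) * qPochInf (q ^ 4) (q ^ 5)) = 1 := by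
  have h := rrG_mul_qPochInf hq
  have hq5 := norm_pow_lt_one' hq (n := 5) (by norm_num)
  have n2 := qPochInf_ne_zero_of_norm_lt (norm_pow_lt_one' hq two_ne_zero) hq5
  have n3 := qPochInf_ne_zero_of_norm_lt (norm_pow_lt_one' hq three_ne_zero) hq5
  have n5 := qPochInf_ne_zero_of_norm_lt hq5 hq5
  rw [selbergTwo_self hq0 hq, qPochInf_eq_prod_five q hq, ← sq, ← pow_succ', ← pow_succ',
    ← pow_succ'] at h
  refine mul_right_cancel₀ (mul_ne_zero (mul_ne_zero n3 n2) n5) ?_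
  linear_combination h

/-- The **second Rogers–Ramanujan identity**. -/
theorem rrH_mul (hq0 : q ≠ 0) (hq : ‖q‖ < 1) :
    rrH q * (qPochInf (q ^ 2) (q ^ 5) * qPochInf (q ^ 3) (q ^ 5)) = 1 := by
  have h := rrH_mul_qPochInf hq
  have hq5 := norm_pow_lt_one' hq (n := 5) (by norm_num)
  have n1 := qPochInf_ne_zero_of_norm_lt hq hq5
  have n4 := qPochInf_ne_zero_of_norm_lt (norm_pow_lt_one' hq four_ne_zero) hq5
  have n5 := qPochInf_ne_zero_of_norm_lt hq5 hq5
  rw [selbergOne_self hq0 hq, qPochInf_eq_prod_five q hq, ← sq, ← pow_succ', ← pow_succ',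
    ← pow_succ'] at h
  refine mul_right_cancel₀ (mul_ne_zero (mul_ne_zero n4 n1) n5) ?_
  linear_combination h

theorem qJ₂_natCast (q : ℂ) (a b : ℕ) :
    qJ₂ q a (a + b) = qPochInf (q ^ a) (q ^ (a + b)) * qPochInf (q ^ b) (q ^ (a + b)) *
      qPochInf (q ^ (a + b)) (q ^ (a + b)) := by
  have : ((a + b : ℕ) : ℤ) - a = b := by push_cast; ring
  rw [qJ₂, this, zpow_natCast, zpow_natCast]

theorem qJ_four_mul_rrG (hq0 : q ≠ 0) (hq : ‖q‖ < 1) : rrG (q ^ 4) * qJ q 4 = qJ₂ q 8 20 := by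
  rw [qJ, rrG_mul_qPochInf (norm_pow_lt_one' hq four_ne_zero),
    selbergTwo_self (pow_ne_zero 4 hq0) (norm_pow_lt_one' hq four_ne_zero)]
  have := qJ₂_natCast q 8 12
  simp only [← pow_mul]
  norm_num at this ⊢
  rw [this]
  ring

theorem qJ_four_mul_rrH (hq0 : q ≠ 0) (hq : ‖q‖ < 1) : rrH (q ^ 4) * qJ q 4 = qJ₂ q 4 20 := by
  rw [qJ, rrH_mul_qPochInf (norm_pow_lt_one' hq four_ne_zero),
    selbergOne_self (pow_ne_zero 4 hq0) (norm_pow_lt_one' hq four_ne_zero)]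
  have := qJ₂_natCast q 4 16
  simp only [← pow_mul]
  norm_num at this ⊢
  rw [this]
  ring

theorem qJ_two_eq_prod (hq : ‖q‖ < 1) :
    qJ q 2 = qPochInf (q ^ 2) (q ^ 10) * qPochInf (q ^ 4) (q ^ 10) * qPochInf (q ^ 6) (q ^ 10) *
      qPochInf (q ^ 8) (q ^ 10) * qPochInf (q ^ 10) (q ^ 10) := by
  rw [qJ, qPochInf_eq_prod_five (q ^ 2) (norm_sq_lt_one hq)]
  simp only [← pow_mul, ← pow_add]

theorem qPochInf_pow_mul_neg_pow (hq : ‖q‖ < 1) (a : ℕ) :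
    qPochInf (q ^ a) (q ^ 10) * qPochInf (-q ^ a) (q ^ 10) = qPochInf (q ^ (2 * a)) (q ^ 20) := by
  rw [qPochInf_mul_neg _ (norm_pow_lt_one' hq (by norm_num)), ← pow_mul, ← pow_mul, mul_comm a]

theorem qPochInf_pow_mul_pow_add (hq : ‖q‖ < 1) (a : ℕ) :
    qPochInf (q ^ a) (q ^ 20) * qPochInf (q ^ (a + 10)) (q ^ 20) = qPochInf (q ^ a) (q ^ 10) := by
  rw [← qPochInf_mul_qPochInf_mul (q ^ a) (norm_pow_lt_one' hq (n := 10) (by norm_num)),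
    ← pow_mul, ← pow_add]

theorem qPochInf_neg_five (hq : ‖q‖ < 1) (a : ℂ) :
    qPochInf a ((-q) ^ 5) = qPochInf a (q ^ 10) * qPochInf (-(a * q ^ 5)) (q ^ 10) := by
  rw [← qPochInf_mul_qPochInf_mul a (q := (-q) ^ 5)
    (norm_pow_lt_one' (by rwa [norm_neg]) (by norm_num))]
  ring_nf

/-- Each base `(-q)⁵` product splits into two of base `q¹⁰`; those with negative argument are
absorbed by `(x;p)_∞ (-x;p)_∞ = (x²;p²)_∞`. -/
theorem rrG_neg_mul_qJ_two (hq0 : q ≠ 0) (hq : ‖q‖ < 1) :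
    rrG (-q) * qJ q 2 * qJ q 20 = qJ₂ q 1 10 * qJ₂ q 8 20 := by
  have h := rrG_mul (neg_ne_zero.2 hq0) (by rwa [norm_neg])
  rw [qPochInf_neg_five hq, qPochInf_neg_five hq] at h
  have e1 : -(-q * q ^ 5) = q ^ 6 := by ring
  have e2 : -((-q) ^ 4 * q ^ 5) = -q ^ 9 := by ring
  have e3 : (-q) ^ 4 = q ^ 4 := by ring
  rw [e1, e2, e3] at h
  have a1 := qPochInf_pow_mul_neg_pow hq 1
  have a9 := qPochInf_pow_mul_neg_pow hq 9
  have b2 := qPochInf_pow_mul_pow_add hq 2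
  have b8 := qPochInf_pow_mul_pow_add hq 8
  have j1 := qJ₂_natCast q 1 9
  have j8 := qJ₂_natCast q 8 12
  norm_num at a1 a9 b2 b8 j1 j8
  rw [j1, j8, qJ_two_eq_prod hq, qJ, ← b2, ← b8, ← a1, ← a9]
  linear_combination (qPochInf q (q ^ 10) * qPochInf (q ^ 12) (q ^ 20) *
    qPochInf (q ^ 8) (q ^ 20) * qPochInf (q ^ 9) (q ^ 10) * qPochInf (q ^ 10) (q ^ 10) *
    qPochInf (q ^ 20) (q ^ 20)) * h

theorem rrH_neg_mul_qJ_two (hq0 : q ≠ 0) (hq : ‖q‖ < 1) :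
    rrH (-q) * qJ q 2 * qJ q 20 = qJ₂ q 3 10 * qJ₂ q 4 20 := by
  have h := rrH_mul (neg_ne_zero.2 hq0) (by rwa [norm_neg])
  rw [qPochInf_neg_five hq, qPochInf_neg_five hq] at h
  have e1 : -((-q) ^ 2 * q ^ 5) = -q ^ 7 := by ring
  have e2 : -((-q) ^ 3 * q ^ 5) = q ^ 8 := by ring
  have e3 : (-q) ^ 2 = q ^ 2 := by ring
  have e4 : (-q) ^ 3 = -q ^ 3 := by ring
  rw [e1, e2, e3, e4] at h
  have a1 := qPochInf_pow_mul_neg_pow hq 3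
  have a9 := qPochInf_pow_mul_neg_pow hq 7
  have b2 := qPochInf_pow_mul_pow_add hq 6
  have b8 := qPochInf_pow_mul_pow_add hq 4
  have j1 := qJ₂_natCast q 3 7
  have j8 := qJ₂_natCast q 4 16
  norm_num at a1 a9 b2 b8 j1 j8
  rw [j1, j8, qJ_two_eq_prod hq, qJ, ← b2, ← b8, ← a1, ← a9]
  linear_combination (qPochInf (q ^ 3) (q ^ 10) * qPochInf (q ^ 16) (q ^ 20) *
    qPochInf (q ^ 4) (q ^ 20) * qPochInf (q ^ 7) (q ^ 10) * qPochInf (q ^ 10) (q ^ 10) *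
    qPochInf (q ^ 20) (q ^ 20)) * h

theorem qJ_ne_zero (hq : ‖q‖ < 1) {m : ℕ} (hm : m ≠ 0) : qJ q m ≠ 0 :=
  qPochInf_ne_zero_of_norm_lt (norm_pow_lt_one' hq hm) (norm_pow_lt_one' hq hm)

theorem qJ_one_eq (hq : ‖q‖ < 1) : qJ q 1 = qPochInf q (q ^ 2) * qJ q 2 := by
  rw [qJ, pow_one, ← qPochInf_mul_qPochInf_mul q hq, qJ, sq]

theorem qJ_four_eq (hq : ‖q‖ < 1) : qJ q 4 = qJ q 2 * qPochInf (-q ^ 2) (q ^ 2) := by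
  rw [qJ, qJ, qPochInf_mul_neg _ (norm_sq_lt_one hq), ← pow_mul]

/-- Euler's theorem on odd and distinct parts, with `q²` as variable. -/
theorem qPochInf_sq_mul_neg_sq (hq : ‖q‖ < 1) :
    qPochInf (q ^ 2) ((q ^ 2) ^ 2) * qPochInf (-q ^ 2) (q ^ 2) = 1 := by
  have h := qPochInf_mul_qPochInf_mul (q ^ 2) (norm_sq_lt_one hq)
  have h4 := qJ_four_eq hq
  refine mul_right_cancel₀ (qJ_ne_zero hq two_ne_zero) ?_
  rw [qJ, qJ] at h4
  rw [qJ]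
  rw [← sq, ← pow_mul, h4] at h
  rw [← pow_mul]
  linear_combination h

theorem qPochInf_mul_neg_mul_neg_sq (hq : ‖q‖ < 1) :
    qPochInf q (q ^ 2) * qPochInf (-q) (q ^ 2) * qPochInf (-q ^ 2) (q ^ 2) = 1 := by
  rw [qPochInf_mul_neg q (norm_sq_lt_one hq), qPochInf_sq_mul_neg_sq hq]

/-- With `A, B, C = (q;q²)_∞, (-q;q²)_∞, (-q²;q²)_∞` one has `J₁ = A J₂`, `J₄ = C J₂`, `R = S A C`,
and the claim reduces to `(ABC)³ = 1`. "Even" refers to `l` in `F(1,1,1,t)`; for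
`F(q⁻¹,q,q⁻¹,q^{-1/2})` this product comes from odd `l`. -/
theorem even_product {S R X : ℂ} (hq : ‖q‖ < 1) (hS : S * qPochInf q (-q) = R)
    (hR : R * qJ q 2 * qJ q 20 = X) :
    qPochInf (-q) (q ^ 2) ^ 3 * S = qJ q 2 ^ 7 * X / (qJ q 1 ^ 4 * qJ q 4 ^ 4 * qJ q 20) := by
  have h1 := qPochInf_mul_neg_mul_neg_sq hq
  have hs := qPochInf_neg_mul (x := -q) (by rwa [norm_neg])
  rw [neg_neg, neg_sq] at hs
  have n2 := qJ_ne_zero hq two_ne_zero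
  have n20 := qJ_ne_zero hq (m := 20) (by norm_num)
  rw [eq_div_iff (mul_ne_zero (mul_ne_zero (pow_ne_zero 4 (qJ_ne_zero hq one_ne_zero))
    (pow_ne_zero 4 (qJ_ne_zero hq four_ne_zero))) n20), qJ_one_eq hq, qJ_four_eq hq, ← hR, ← hS,
    ← hs]
  set A := qPochInf q (q ^ 2)
  set B := qPochInf (-q) (q ^ 2)
  set C := qPochInf (-q ^ 2) (q ^ 2)
  have h3 : (A * B * C) ^ 3 = 1 := by rw [h1, one_pow]
  linear_combination (S * A * C * qJ q 2 ^ 8 * qJ q 20) * h3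

theorem odd_product {S R X : ℂ} (hq : ‖q‖ < 1)
    (hS : S * qPochInf (q ^ 2) ((q ^ 2) ^ 2) = R) (hR : R * qJ q 4 = X) :
    qPochInf (-q ^ 2) (q ^ 2) ^ 3 * S = qJ q 4 ^ 3 * X / qJ q 2 ^ 4 := by
  have h1 := qPochInf_sq_mul_neg_sq hq
  rw [eq_div_iff (pow_ne_zero 4 (qJ_ne_zero hq two_ne_zero)), ← hR, ← hS, qJ_four_eq hq]
  linear_combination (-S * qPochInf (-q ^ 2) (q ^ 2) ^ 3 * qJ q 2 ^ 4) * h1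

end Products

/-! ### Reduction of the quadruple series to a sum over `l` -/

section Nahm

variable {q r : ℂ}

/-- One factor of the quadruple series. -/
noncomputable def nahmFactor (r u : ℂ) (d : ℤ) (i : ℕ) : ℂ :=
  u ^ i * r ^ (4 * (i : ℤ) ^ 2 + 4 * (i : ℤ) * d) * (qPoch ((r ^ 4) ^ 2) ((r ^ 4) ^ 2) i)⁻¹

/-- The factor of the quadruple series that depends only on the last summation index. -/
noncomputable def nahmWeight (r t : ℂ) (l : ℕ) : ℂ :=
  t ^ l * r ^ (5 * l ^ 2) * (qPoch ((r ^ 4) ^ 2) ((r ^ 4) ^ 2) l)⁻¹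

theorem nahmTerm_eq (hr0 : r ≠ 0) (u v w t : ℂ) (i j k l : ℕ) :
    nahmTerm r u v w t (i, j, k, l) = nahmWeight r t l *
      (nahmFactor r u (-l) i * (nahmFactor r v (-l) j * nahmFactor r w l k)) := by
  have e : (4 * (i : ℤ) ^ 2 + 4 * (j : ℤ) ^ 2 + 4 * (k : ℤ) ^ 2 + 5 * (l : ℤ) ^ 2
      - 4 * (i : ℤ) * l - 4 * (j : ℤ) * l + 4 * (k : ℤ) * l) =
      ((5 * l ^ 2 : ℕ) : ℤ) + (4 * (i : ℤ) ^ 2 + 4 * (i : ℤ) * (-l)) +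
        (4 * (j : ℤ) ^ 2 + 4 * (j : ℤ) * (-l)) + (4 * (k : ℤ) ^ 2 + 4 * (k : ℤ) * l) := by
    push_cast; ring
  rw [nahmTerm, e, zpow_add₀ hr0, zpow_add₀ hr0, zpow_add₀ hr0, zpow_natCast, nahmWeight,
    nahmFactor, nahmFactor, nahmFactor, div_eq_mul_inv]
  simp only [mul_inv]
  ring

theorem norm_lt_one_of_pow_four (hr : ‖r ^ 4‖ < 1) : ‖r‖ < 1 := by
  rw [norm_pow] at hr
  exact (pow_lt_one_iff_of_nonneg (norm_nonneg _) four_ne_zero).1 hr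

theorem summable_nahmTerm (hr0 : r ≠ 0) (hr : ‖r‖ < 1) (u v w t : ℂ) :
    Summable (nahmTerm r u v w t) := by
  have hp : ‖(r ^ 4) ^ 2‖ < 1 := norm_sq_lt_one (norm_pow_lt_one' hr four_ne_zero)
  obtain ⟨C, hC0, hC⟩ := exists_norm_inv_qPoch_le hp hp
  have hs : ∀ x : ℂ, Summable fun n : ℕ => ‖x‖ ^ n * ‖r‖ ^ n ^ 2 * C := by
    intro x
    refine ((summable_pow_choose_two_mul_pow (sq_nonneg ‖r‖)
      (pow_lt_one₀ (norm_nonneg _) hr two_ne_zero) (‖r‖ * ‖x‖)).mul_right C).congr fun n => ?_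
    rw [two_mul_choose_two_add n, pow_add, pow_mul, mul_pow]
    ring
  have hnn : ∀ x : ℂ, 0 ≤ fun n : ℕ => ‖x‖ ^ n * ‖r‖ ^ n ^ 2 * C := fun x n => by positivity
  have h2 := (hs w).mul_of_nonneg (hs t) (hnn w) (hnn t)
  have h3 := (hs v).mul_of_nonneg h2 (hnn v)
    fun p => mul_nonneg (hnn w p.1) (hnn t p.2)
  have h4 := (hs u).mul_of_nonneg h3 (hnn u)
    fun p => mul_nonneg (hnn v p.1) (mul_nonneg (hnn w p.2.1) (hnn t p.2.2))
  refine Summable.of_norm_bounded h4 ?_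
  rintro ⟨i, j, k, l⟩
  simp only [nahmTerm, div_eq_mul_inv, mul_inv, norm_mul, norm_pow, norm_zpow]
  have hE : ‖r‖ ^ (4 * (i : ℤ) ^ 2 + 4 * (j : ℤ) ^ 2 + 4 * (k : ℤ) ^ 2 + 5 * (l : ℤ) ^ 2
      - 4 * (i : ℤ) * l - 4 * (j : ℤ) * l + 4 * (k : ℤ) * l) ≤
      ‖r‖ ^ i ^ 2 * ‖r‖ ^ j ^ 2 * ‖r‖ ^ k ^ 2 * ‖r‖ ^ l ^ 2 := by
    rw [← pow_add, ← pow_add, ← pow_add, ← zpow_natCast]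
    refine zpow_le_zpow_right_of_le_one₀ (norm_pos_iff.2 hr0) hr.le ?_
    push_cast
    have hkl : (0 : ℤ) ≤ k * l := by positivity
    -- The form minus `i² + j² + k² + l²` equals `(3i-2l)²/3 + (3j-2l)²/3 + 3k² + 4l²/3 + 4kl`.
    nlinarith [sq_nonneg (3 * (i : ℤ) - 2 * l), sq_nonneg (3 * (j : ℤ) - 2 * l),
      sq_nonneg (k : ℤ), sq_nonneg (l : ℤ)]
  have hi := hC i
  have hj := hC j
  have hk := hC k
  have hl := hC l
  calc _ ≤ ‖u‖ ^ i * ‖v‖ ^ j * ‖w‖ ^ k * ‖t‖ ^ l *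
        (‖r‖ ^ i ^ 2 * ‖r‖ ^ j ^ 2 * ‖r‖ ^ k ^ 2 * ‖r‖ ^ l ^ 2) * (C * C * C * C) := by
        simp only [norm_inv] at hi hj hk hl ⊢
        gcongr
    _ = _ := by ring

theorem nahmFactor_eq (hr0 : r ≠ 0) (hr : r ^ 4 = q) (u : ℂ) (d : ℤ) (i : ℕ) :
    nahmFactor r u d i =
      (q ^ 2) ^ i.choose 2 * (u * q ^ (1 + d)) ^ i / qPoch (q ^ 2) (q ^ 2) i := by
  subst hr
  have h2 : ((i ^ 2 : ℕ) : ℤ) = ((2 * i.choose 2 + i : ℕ) : ℤ) :=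
    congrArg Nat.cast (two_mul_choose_two_add i)
  push_cast at h2
  have e : r ^ (4 * (i : ℤ) ^ 2 + 4 * (i : ℤ) * d) =
      ((r ^ 4) ^ 2) ^ i.choose 2 * ((r ^ 4) ^ (1 + d)) ^ i := by
    rw [← pow_mul, ← pow_mul, ← zpow_natCast r, ← zpow_natCast ((r ^ 4) ^ (1 + d)),
      ← zpow_natCast r 4, ← zpow_mul, ← zpow_mul, ← zpow_add₀ hr0]
    congr 1
    push_cast
    rw [h2]
    ring
  rw [nahmFactor, e, mul_pow, div_eq_mul_inv]
  ring

theorem nahmF_eq_tsum (hr0 : r ≠ 0) (hr : r ^ 4 = q) (hq : ‖q‖ < 1) (u v w t : ℂ) :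
    Summable (fun l : ℕ => nahmWeight r t l *
      (qPochInf (-(u * q ^ (1 + -(l : ℤ)))) (q ^ 2) * (qPochInf (-(v * q ^ (1 + -(l : ℤ)))) (q ^ 2) *
        qPochInf (-(w * q ^ (1 + (l : ℤ)))) (q ^ 2)))) ∧
    nahmF r u v w t = ∑' l : ℕ, nahmWeight r t l *
      (qPochInf (-(u * q ^ (1 + -(l : ℤ)))) (q ^ 2) * (qPochInf (-(v * q ^ (1 + -(l : ℤ)))) (q ^ 2) *
        qPochInf (-(w * q ^ (1 + (l : ℤ)))) (q ^ 2))) := by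
  have hq2 := norm_sq_lt_one hq
  have hsum : ∀ (u : ℂ) (d : ℤ), Summable fun i => ‖nahmFactor r u d i‖ := fun u d => by
    simp only [nahmFactor_eq hr0 hr]
    exact summable_norm_euler hq2 _
  have htsum : ∀ (u : ℂ) (d : ℤ),
      ∑' i, nahmFactor r u d i = qPochInf (-(u * q ^ (1 + d))) (q ^ 2) := fun u d => by
    simp only [nahmFactor_eq hr0 hr]
    exact tsum_euler hq2 _
  -- Moves `l` to the front so that it becomes the outer summation index.
  let e : ℕ × ℕ × ℕ × ℕ ≃ ℕ × ℕ × ℕ × ℕ :=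
    { toFun := fun p => (p.2.1, p.2.2.1, p.2.2.2, p.1)
      invFun := fun p => (p.2.2.2, p.1, p.2.1, p.2.2.1)
      left_inv := fun _ => rfl
      right_inv := fun _ => rfl }
  have hs : Summable fun p => nahmTerm r u v w t (e p) :=
    e.summable_iff.2 (summable_nahmTerm hr0 (norm_lt_one_of_pow_four (hr ▸ hq)) u v w t)
  have inner : ∀ l : ℕ, ∑' p : ℕ × ℕ × ℕ, nahmTerm r u v w t (e (l, p)) = nahmWeight r t l *
      (qPochInf (-(u * q ^ (1 + -(l : ℤ)))) (q ^ 2) * (qPochInf (-(v * q ^ (1 + -(l : ℤ)))) (q ^ 2) *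
        qPochInf (-(w * q ^ (1 + (l : ℤ)))) (q ^ 2))) := by
    intro l
    have hvw : Summable fun p : ℕ × ℕ => ‖nahmFactor r v (-l) p.1 * nahmFactor r w l p.2‖ :=
      Summable.mul_norm (hsum v (-l)) (hsum w l)
    rw [← htsum, ← htsum, ← htsum, tsum_mul_tsum_of_summable_norm (hsum v (-l)) (hsum w l),
      tsum_mul_tsum_of_summable_norm (hsum u (-l)) hvw, ← tsum_mul_left]
    exact tsum_congr fun p => nahmTerm_eq hr0 u v w t _ _ _ _
  refine ⟨hs.prod.congr fun l => inner l, ?_⟩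
  rw [nahmF, ← e.tsum_eq, hs.tsum_prod]
  exact tsum_congr inner

/-- The reversal of a shifted infinite product, odd exponents. -/
theorem qPochInf_neg_zpow_odd (hq0 : q ≠ 0) (hq : ‖q‖ < 1) (m : ℕ) :
    qPochInf (-(q ^ (1 - 2 * (m : ℤ)))) (q ^ 2) =
      qPochInf (-q) (q ^ 2) * (q ^ m ^ 2)⁻¹ * qPoch (-q) (q ^ 2) m := by
  induction m with
  | zero => simp [qPoch]
  | succ m ih =>
    have e : -(q ^ (1 - 2 * ((m + 1 : ℕ) : ℤ))) * q ^ 2 = -(q ^ (1 - 2 * (m : ℤ))) := by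
      rw [← zpow_natCast q 2, neg_mul, ← zpow_add₀ hq0]
      congr 2
      push_cast
      ring
    have e2 : q ^ (1 - 2 * ((m + 1 : ℕ) : ℤ)) = (q ^ (2 * m + 1))⁻¹ := by
      rw [← zpow_natCast, ← zpow_neg]
      congr 1
    rw [qPochInf_eq_one_sub_mul _ (norm_sq_lt_one hq), e, ih, e2, qPoch_succ]
    have h1 : q ^ (2 * m + 1) ≠ 0 := pow_ne_zero _ hq0
    have h2 : q ^ m ^ 2 ≠ 0 := pow_ne_zero _ hq0
    have h3 : q ^ (m + 1) ^ 2 = q ^ m ^ 2 * q ^ (2 * m + 1) := by ring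
    rw [h3]
    field_simp
    ring

/-- The reversal of a shifted infinite product, even exponents. -/
theorem qPochInf_neg_zpow_even (hq0 : q ≠ 0) (hq : ‖q‖ < 1) (m : ℕ) :
    qPochInf (-(q ^ (-(2 * (m : ℤ))))) (q ^ 2) =
      2 * qPochInf (-q ^ 2) (q ^ 2) * (q ^ (m ^ 2 + m))⁻¹ * qPoch (-q ^ 2) (q ^ 2) m := by
  induction m with
  | zero =>
    -- The leading factor is `1 + q^0 = 2`; two such products give the coefficient 4 of the final
    -- formulas.
    rw [qPochInf_eq_one_sub_mul _ (norm_sq_lt_one hq)]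
    simp [qPoch]
    norm_num
  | succ m ih =>
    have e : -(q ^ (-(2 * ((m + 1 : ℕ) : ℤ)))) * q ^ 2 = -(q ^ (-(2 * (m : ℤ)))) := by
      rw [← zpow_natCast q 2, neg_mul, ← zpow_add₀ hq0]
      congr 2
      push_cast
      ring
    have e2 : q ^ (-(2 * ((m + 1 : ℕ) : ℤ))) = (q ^ (2 * m + 2))⁻¹ := by
      rw [← zpow_natCast, ← zpow_neg]
      congr 1
    rw [qPochInf_eq_one_sub_mul _ (norm_sq_lt_one hq), e, ih, e2, qPoch_succ]
    have h1 : q ^ (2 * m + 2) ≠ 0 := pow_ne_zero _ hq0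
    have h2 : q ^ (m ^ 2 + m) ≠ 0 := pow_ne_zero _ hq0
    have h3 : q ^ ((m + 1) ^ 2 + (m + 1)) = q ^ (m ^ 2 + m) * q ^ (2 * m + 2) := by ring
    rw [h3]
    field_simp
    ring

theorem qPochInf_neg_pow_odd (hq : ‖q‖ < 1) (m : ℕ) :
    qPochInf (-(q ^ (2 * m + 1))) (q ^ 2) =
      qPochInf (-q) (q ^ 2) * (qPoch (-q) (q ^ 2) m)⁻¹ := by
  rw [← qPochInf_mul_pow (by rwa [norm_neg]) (norm_sq_lt_one hq)]
  ring_nf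

theorem qPochInf_neg_pow_even (hq : ‖q‖ < 1) (m : ℕ) :
    qPochInf (-(q ^ (2 * m + 2))) (q ^ 2) =
      qPochInf (-q ^ 2) (q ^ 2) * (qPoch (-q ^ 2) (q ^ 2) m)⁻¹ := by
  rw [← qPochInf_mul_pow (by rw [norm_neg]; exact norm_sq_lt_one hq) (norm_sq_lt_one hq)]
  ring_nf

theorem qPoch_two_mul_add_one (a q : ℂ) (n : ℕ) :
    qPoch a q (2 * n + 1) = qPoch a (q ^ 2) (n + 1) * qPoch (a * q) (q ^ 2) n := by
  rw [qPoch_succ, qPoch_two_mul, qPoch_succ]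
  ring

theorem qPoch_sq_two_mul (q : ℂ) (m : ℕ) :
    qPoch (q ^ 2) (q ^ 2) (2 * m) =
      qPoch q (q ^ 2) m * qPoch (-q) (q ^ 2) m * qPoch (q ^ 4) (q ^ 4) m := by
  rw [qPoch_two_mul, qPoch_mul_neg, ← pow_mul, ← pow_add]

theorem qPoch_sq_two_mul_add_one (q : ℂ) (m : ℕ) :
    qPoch (q ^ 2) (q ^ 2) (2 * m + 1) =
      qPoch q (q ^ 2) (m + 1) * qPoch (-q) (q ^ 2) (m + 1) * qPoch (q ^ 4) (q ^ 4) m := by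
  rw [qPoch_two_mul_add_one, qPoch_mul_neg, ← pow_mul, ← pow_add]

theorem qPoch_sq_two_mul' (q : ℂ) (m : ℕ) :
    qPoch (q ^ 2) (q ^ 2) (2 * m) = qPoch (q ^ 2) ((q ^ 2) ^ 2) m *
      (qPoch (q ^ 2) (q ^ 2) m * qPoch (-q ^ 2) (q ^ 2) m) := by
  rw [qPoch_two_mul, qPoch_mul_neg, ← sq]

theorem qPoch_sq_two_mul_add_one' (q : ℂ) (m : ℕ) :
    qPoch (q ^ 2) (q ^ 2) (2 * m + 1) = qPoch (q ^ 2) ((q ^ 2) ^ 2) (m + 1) *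
      (qPoch (q ^ 2) (q ^ 2) m * qPoch (-q ^ 2) (q ^ 2) m) := by
  rw [qPoch_two_mul_add_one, qPoch_mul_neg, ← sq]

theorem nahmF_eq_even_add_odd (hr0 : r ≠ 0) (hr : r ^ 4 = q) (hq : ‖q‖ < 1) {u v w t : ℂ}
    {f g : ℕ → ℂ}
    (hf : ∀ m : ℕ, nahmWeight r t (2 * m) *
      (qPochInf (-(u * q ^ (1 - 2 * (m : ℤ)))) (q ^ 2) *
        (qPochInf (-(v * q ^ (1 - 2 * (m : ℤ)))) (q ^ 2) *
        qPochInf (-(w * q ^ (2 * m + 1))) (q ^ 2))) = f m)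
    (hg : ∀ m : ℕ, nahmWeight r t (2 * m + 1) *
      (qPochInf (-(u * q ^ (-(2 * (m : ℤ))))) (q ^ 2) *
        (qPochInf (-(v * q ^ (-(2 * (m : ℤ))))) (q ^ 2) *
        qPochInf (-(w * q ^ (2 * m + 2))) (q ^ 2))) = g m) :
    nahmF r u v w t = ∑' m, f m + ∑' m, g m := by
  obtain ⟨hs, h⟩ := nahmF_eq_tsum hr0 hr hq u v w t
  set F : ℕ → ℂ := fun l => nahmWeight r t l *
    (qPochInf (-(u * q ^ (1 + -(l : ℤ)))) (q ^ 2) * (qPochInf (-(v * q ^ (1 + -(l : ℤ)))) (q ^ 2) *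
      qPochInf (-(w * q ^ (1 + (l : ℤ)))) (q ^ 2))) with hF
  have he : Summable fun m : ℕ => F (2 * m) :=
    hs.comp_injective (i := fun m : ℕ => 2 * m) fun a b hab => by simpa using hab
  have ho : Summable fun m : ℕ => F (2 * m + 1) :=
    hs.comp_injective (i := fun m : ℕ => 2 * m + 1) fun a b hab => by simpa using hab
  rw [h, ← tsum_even_add_odd (f := F) he ho]
  congr 1
  · refine tsum_congr fun m => ?_
    rw [← hf m, hF]
    dsimp only
    have e1 : (1 : ℤ) + -((2 * m : ℕ) : ℤ) = 1 - 2 * m := by push_cast; ring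
    have e2 : q ^ ((1 : ℤ) + ((2 * m : ℕ) : ℤ)) = q ^ (2 * m + 1) := by
      rw [← zpow_natCast]
      congr 1
      push_cast
      ring
    rw [e1, e2]
  · refine tsum_congr fun m => ?_
    rw [← hg m, hF]
    dsimp only
    have e1 : (1 : ℤ) + -((2 * m + 1 : ℕ) : ℤ) = -(2 * m) := by push_cast; ring
    have e2 : q ^ ((1 : ℤ) + ((2 * m + 1 : ℕ) : ℤ)) = q ^ (2 * m + 2) := by
      rw [← zpow_natCast]
      congr 1
      push_cast
      ring
    rw [e1, e2]

theorem nahmWeight_even (hr : r ^ 4 = q) (t : ℂ) (m : ℕ) :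
    nahmWeight r t (2 * m) =
      (t ^ 2) ^ m * q ^ (5 * m ^ 2) * (qPoch (q ^ 2) (q ^ 2) (2 * m))⁻¹ := by
  subst hr
  rw [nahmWeight]
  ring

theorem nahmWeight_odd (hr : r ^ 4 = q) (t : ℂ) (m : ℕ) :
    nahmWeight r t (2 * m + 1) = t * r ^ 5 * (t ^ 2) ^ m * q ^ (5 * m ^ 2 + 5 * m) *
      (qPoch (q ^ 2) (q ^ 2) (2 * m + 1))⁻¹ := by
  subst hr
  rw [nahmWeight]
  ring

end Nahm

/-! ### Specialisations and product formulas -/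

section Main

variable {q r : ℂ}

theorem neg_one_pow_mul_neg_pow (q : ℂ) {m n : ℕ} (h : Even (m + n)) :
    (-1) ^ m * (-q) ^ n = q ^ n := by
  rw [neg_pow q, ← mul_assoc, ← pow_add, h.neg_one_pow, one_mul]

theorem even_add_three_mul_sq (m : ℕ) : Even (m + 3 * m ^ 2) := by
  have := Nat.even_mul_succ_self m
  have e : m + 3 * m ^ 2 = m * (m + 1) + 2 * m ^ 2 := by ring
  rw [e]
  exact this.add (even_two_mul _)

theorem tsum_mul_qPochInf_eq_rrG_neg (hq : ‖q‖ < 1) :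
    (∑' m : ℕ, q ^ (3 * m ^ 2) * (qPoch q (q ^ 2) m * qPoch (q ^ 4) (q ^ 4) m)⁻¹) *
      qPochInf q (-q) = rrG (-q) := by
  have h := tsum_mul_qPochInf_neg_eq_rrG (x := -q) (by rwa [norm_neg])
  simpa only [neg_neg, neg_sq, show (-q) ^ 4 = q ^ 4 by ring,
    neg_one_pow_mul_neg_pow q (even_add_three_mul_sq _)] using h

theorem tsum_mul_qPochInf_eq_rrH_neg (hq : ‖q‖ < 1) :
    (∑' m : ℕ, q ^ (6 * m.choose 2 + m) *
      (qPoch q (q ^ 2) m * qPoch (q ^ 4) (q ^ 4) m)⁻¹) * qPochInf q (-q) = rrH (-q) := by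
  have h := tsum_mul_qPochInf_neg_eq_rrH (x := -q) (by rwa [norm_neg])
  have hp : ∀ m : ℕ, Even (m + (6 * m.choose 2 + m)) := fun m => ⟨3 * m.choose 2 + m, by ring⟩
  simpa only [neg_neg, neg_sq, show (-q) ^ 4 = q ^ 4 by ring,
    neg_one_pow_mul_neg_pow q (hp _)] using h

theorem tsum_succ_mul_qPochInf_eq_rrH_neg (hq : ‖q‖ < 1) :
    (∑' m : ℕ, q ^ (3 * m ^ 2 + 2 * m) *
      (qPoch q (q ^ 2) (m + 1) * qPoch (q ^ 4) (q ^ 4) m)⁻¹) * qPochInf q (-q) = rrH (-q) := by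
  have h := tsum_succ_mul_qPochInf_neg_eq_rrH (x := -q) (by rwa [norm_neg])
  have hp : ∀ m : ℕ, Even (m + (3 * m ^ 2 + 2 * m)) := fun m => by
    rw [← add_assoc]
    exact (even_add_three_mul_sq m).add (even_two_mul m)
  simpa only [neg_neg, neg_sq, show (-q) ^ 4 = q ^ 4 by ring,
    neg_one_pow_mul_neg_pow q (hp _)] using h

theorem qPoch_neg_ne_zero (hq : ‖q‖ < 1) (m : ℕ) : qPoch (-q) (q ^ 2) m ≠ 0 :=
  qPoch_ne_zero_of_norm_lt (by rwa [norm_neg]) (norm_sq_lt_one hq) m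

theorem qPoch_neg_sq_ne_zero (hq : ‖q‖ < 1) (m : ℕ) : qPoch (-q ^ 2) (q ^ 2) m ≠ 0 :=
  qPoch_ne_zero_of_norm_lt (by rw [norm_neg]; exact norm_sq_lt_one hq) (norm_sq_lt_one hq) m

/-- The two reversed products lower the exponent from `5m²` to `3m²` (from `5m² + 5m` to `3m² + 3m`
for odd `l`). Of their two finite factorials, one cancels against the third product and one against
part of `(q²;q²)_l`. -/
theorem nahmF_one_one_one (hr0 : r ≠ 0) (hr : r ^ 4 = q) (hq : ‖q‖ < 1) (t : ℂ) :
    nahmF r 1 1 1 t =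
      qPochInf (-q) (q ^ 2) ^ 3 * ∑' m : ℕ, (t ^ 2) ^ m * q ^ (3 * m ^ 2) *
        (qPoch q (q ^ 2) m * qPoch (q ^ 4) (q ^ 4) m)⁻¹ +
      4 * (t * r ^ 5) * (qPochInf (-q ^ 2) (q ^ 2) ^ 3 *
        ∑' m : ℕ, (t ^ 2) ^ m * q ^ (3 * m ^ 2 + 3 * m) *
        (qPoch (q ^ 2) ((q ^ 2) ^ 2) (m + 1) * qPoch (q ^ 2) (q ^ 2) m)⁻¹) := by
  have hq0 : q ≠ 0 := hr ▸ pow_ne_zero 4 hr0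
  rw [← tsum_mul_left, ← tsum_mul_left, ← tsum_mul_left]
  refine nahmF_eq_even_add_odd hr0 hr hq (fun m => ?_) fun m => ?_
  · have hb := qPoch_neg_ne_zero hq m
    have hm : q ^ m ^ 2 ≠ 0 := pow_ne_zero _ hq0
    rw [one_mul, one_mul, qPochInf_neg_zpow_odd hq0 hq, qPochInf_neg_pow_odd hq,
      nahmWeight_even hr, qPoch_sq_two_mul,
      show q ^ (5 * m ^ 2) = q ^ (3 * m ^ 2) * (q ^ m ^ 2) ^ 2 by ring]
    field_simp
  · have hb := qPoch_neg_sq_ne_zero hq m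
    have hm : q ^ (m ^ 2 + m) ≠ 0 := pow_ne_zero _ hq0
    rw [one_mul, one_mul, qPochInf_neg_zpow_even hq0 hq, qPochInf_neg_pow_even hq,
      nahmWeight_odd hr, qPoch_sq_two_mul_add_one',
      show q ^ (5 * m ^ 2 + 5 * m) = q ^ (3 * m ^ 2 + 3 * m) * (q ^ (m ^ 2 + m)) ^ 2 by ring]
    field_simp
    ring

/-- The two products whose arguments are shifted in opposite directions. -/
theorem qPochInf_neg_zpow_mul_pow (hq0 : q ≠ 0) (hq : ‖q‖ < 1) (m : ℕ) :
    qPochInf (-(q * q ^ (1 - 2 * (m : ℤ)))) (q ^ 2) * qPochInf (-(q ^ (2 * m))) (q ^ 2) =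
      q ^ (2 * m) * (qPochInf (-(q ^ (-(2 * (m : ℤ))))) (q ^ 2) *
        qPochInf (-(q ^ (2 * m + 2))) (q ^ 2)) := by
  have hq2 := norm_sq_lt_one hq
  have hm : q ^ (2 * m) ≠ 0 := pow_ne_zero _ hq0
  have e1 : q ^ (-(2 * (m : ℤ))) = (q ^ (2 * m))⁻¹ := by
    rw [← zpow_natCast, ← zpow_neg]
    congr 1
  have e2 : q ^ (1 - 2 * (m : ℤ)) = q * (q ^ (2 * m))⁻¹ := by
    rw [sub_eq_add_neg, zpow_add₀ hq0, zpow_one, e1]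
  rw [e1, e2, qPochInf_eq_one_sub_mul (-(q ^ (2 * m))) hq2,
    qPochInf_eq_one_sub_mul (-(q ^ (2 * m))⁻¹) hq2,
    show -(q ^ (2 * m))⁻¹ * q ^ 2 = -(q * (q * (q ^ (2 * m))⁻¹)) by ring,
    show -(q ^ (2 * m)) * q ^ 2 = -(q ^ (2 * m + 2)) by ring]
  field_simp
  ring

/-- The factors `q^{±1}` in the arguments exchange the two parities: even `l` now leads to
`(-q²;q²)_∞³` and odd `l` to `(-q;q²)_∞³`. -/
theorem nahmF_inv_self_inv (hr0 : r ≠ 0) (hr : r ^ 4 = q) (hq : ‖q‖ < 1) :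
    nahmF r q⁻¹ q q⁻¹ (r ^ 2)⁻¹ =
      4 * (qPochInf (-q ^ 2) (q ^ 2) ^ 3 * ∑' m : ℕ, (q ^ 2) ^ (3 * m.choose 2 + m) *
        (qPoch (q ^ 2) ((q ^ 2) ^ 2) m * qPoch (q ^ 2) (q ^ 2) m)⁻¹) +
      r⁻¹ * (qPochInf (-q) (q ^ 2) ^ 3 * ∑' m : ℕ, q ^ (3 * m ^ 2 + 2 * m) *
        (qPoch q (q ^ 2) (m + 1) * qPoch (q ^ 4) (q ^ 4) m)⁻¹) := by
  have hq0 : q ≠ 0 := hr ▸ pow_ne_zero 4 hr0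
  have ht : ((r ^ 2)⁻¹) ^ 2 = q⁻¹ := by rw [inv_pow, ← pow_mul, hr]
  rw [← tsum_mul_left, ← tsum_mul_left, ← tsum_mul_left, ← tsum_mul_left]
  refine nahmF_eq_even_add_odd hr0 hr hq (fun m => ?_) fun m => ?_
  · have hb := qPoch_neg_sq_ne_zero hq m
    have hm : q ^ (m ^ 2 + m) ≠ 0 := pow_ne_zero _ hq0
    have e1 : q⁻¹ * q ^ (1 - 2 * (m : ℤ)) = q ^ (-(2 * (m : ℤ))) := by
      rw [sub_eq_add_neg, zpow_add₀ hq0, zpow_one, inv_mul_cancel_left₀ hq0]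
    have e2 : q⁻¹ * q ^ (2 * m + 1) = q ^ (2 * m) := by
      rw [pow_succ', inv_mul_cancel_left₀ hq0]
    rw [e1, e2, qPochInf_neg_zpow_mul_pow hq0 hq, qPochInf_neg_zpow_even hq0 hq,
      qPochInf_neg_pow_even hq, nahmWeight_even hr, qPoch_sq_two_mul', ht, inv_pow,
      show q ^ (5 * m ^ 2) = q ^ (4 * m ^ 2) * q ^ m ^ 2 by ring, two_mul_choose_two_add m]
    have hqm : q ^ m ≠ 0 := pow_ne_zero _ hq0
    field_simp
    ring
  · have hb := qPoch_neg_ne_zero hq m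
    have hm : q ^ m ^ 2 ≠ 0 := pow_ne_zero _ hq0
    have hm' : q ^ (m + 1) ^ 2 ≠ 0 := pow_ne_zero _ hq0
    have hb' := qPoch_neg_ne_zero hq (m + 1)
    have e1 : q⁻¹ * q ^ (-(2 * (m : ℤ))) = q ^ (1 - 2 * ((m + 1 : ℕ) : ℤ)) := by
      rw [← zpow_neg_one, ← zpow_add₀ hq0]
      congr 1
      push_cast
      ring
    have e2 : q * q ^ (-(2 * (m : ℤ))) = q ^ (1 - 2 * (m : ℤ)) := by
      rw [sub_eq_add_neg, zpow_add₀ hq0, zpow_one]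
    have e3 : q⁻¹ * q ^ (2 * m + 2) = q ^ (2 * m + 1) := by
      rw [pow_succ' q (2 * m + 1), inv_mul_cancel_left₀ hq0]
    have e4 : q ^ (5 * m ^ 2 + 5 * m) * r ^ 4 =
        q ^ (3 * m ^ 2 + 2 * m) * (q ^ m * (q ^ m ^ 2 * q ^ (m + 1) ^ 2)) := by
      rw [hr]
      ring
    rw [e1, e2, e3, qPochInf_neg_zpow_odd hq0 hq, qPochInf_neg_zpow_odd hq0 hq,
      qPochInf_neg_pow_odd hq, nahmWeight_odd hr, qPoch_sq_two_mul_add_one, ht]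
    have hA : (r ^ 2)⁻¹ * r ^ 5 = r⁻¹ * r ^ 4 := by field_simp
    rw [hA, inv_pow]
    have hqm : q ^ m ≠ 0 := pow_ne_zero _ hq0
    calc _ = r⁻¹ * (q ^ m)⁻¹ * (q ^ (5 * m ^ 2 + 5 * m) * r ^ 4) *
          (qPoch q (q ^ 2) (m + 1) * qPoch (-q) (q ^ 2) (m + 1) * qPoch (q ^ 4) (q ^ 4) m)⁻¹ *
          (qPochInf (-q) (q ^ 2) * (q ^ (m + 1) ^ 2)⁻¹ * qPoch (-q) (q ^ 2) (m + 1) *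
          (qPochInf (-q) (q ^ 2) * (q ^ m ^ 2)⁻¹ * qPoch (-q) (q ^ 2) m *
          (qPochInf (-q) (q ^ 2) * (qPoch (-q) (q ^ 2) m)⁻¹))) := by ring
      _ = _ := by
        rw [e4]
        field_simp

end Main

theorem mainTheorem4 (q r : ℂ) (hr : r ^ 4 = q) (hq0 : q ≠ 0) (hq1 : ‖q‖ < 1) :
    (∀ u v w t : ℂ, Summable (nahmTerm r u v w t)) ∧
    (∀ u v w t : ℂ, nahmF r u v w t = nahmF r v u w t) ∧
    nahmF r q⁻¹ q q⁻¹ (r ^ 2)⁻¹ =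
      4 * (qJ q 4 ^ 3 * qJ₂ q 8 20 / qJ q 2 ^ 4)
        + r⁻¹ * (qJ q 2 ^ 7 * qJ₂ q 3 10 * qJ₂ q 4 20 / (qJ q 1 ^ 4 * qJ q 4 ^ 4 * qJ q 20)) ∧
    nahmF r 1 1 1 q⁻¹ =
      qJ q 2 ^ 7 * qJ₂ q 3 10 * qJ₂ q 4 20 / (qJ q 1 ^ 4 * qJ q 4 ^ 4 * qJ q 20)
        + 4 * r * (qJ q 4 ^ 3 * qJ₂ q 8 20 / qJ q 2 ^ 4) ∧
    nahmF r 1 1 1 1 =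
      qJ q 2 ^ 7 * qJ₂ q 1 10 * qJ₂ q 8 20 / (qJ q 1 ^ 4 * qJ q 4 ^ 4 * qJ q 20)
        + 4 * r ^ 5 * (qJ q 4 ^ 3 * qJ₂ q 4 20 / qJ q 2 ^ 4) := by
  have hr0 : r ≠ 0 := by
    rintro rfl
    exact hq0 (by rw [← hr]; norm_num)
  have hq2 := norm_sq_lt_one hq1
  have hG := rrG_neg_mul_qJ_two hq0 hq1
  have hH := rrH_neg_mul_qJ_two hq0 hq1
  have hG4 := qJ_four_mul_rrG hq0 hq1
  have hH4 := qJ_four_mul_rrH hq0 hq1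
  rw [show q ^ 4 = (q ^ 2) ^ 2 by ring] at hG4 hH4
  have hchoose : ∀ m : ℕ, 3 * m ^ 2 = 6 * m.choose 2 + 3 * m := fun m => by
    rw [two_mul_choose_two_add m]
    ring
  refine ⟨summable_nahmTerm hr0 (norm_lt_one_of_pow_four (hr ▸ hq1)), fun u v w t => ?_, ?_, ?_, ?_⟩
  · rw [(nahmF_eq_tsum hr0 hr hq1 u v w t).2, (nahmF_eq_tsum hr0 hr hq1 v u w t).2]
    exact tsum_congr fun l => by ring
  · rw [nahmF_inv_self_inv hr0 hr hq1, odd_product hq1 (tsum_mul_qPochInf_eq_rrG hq2) hG4,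
      even_product hq1 (tsum_succ_mul_qPochInf_eq_rrH_neg hq1) hH, mul_assoc (qJ q 2 ^ 7)]
  -- The choice `t = q⁻¹` contributes `q^{-2m}`, bringing the exponents to the form of the evaluated
  -- Slater-type series.
  · have e1 : ∀ m : ℕ, ((q⁻¹) ^ 2) ^ m * q ^ (3 * m ^ 2) = q ^ (6 * m.choose 2 + m) := fun m => by
      rw [hchoose, inv_pow, inv_pow]
      field_simp
      ring
    have e2 : ∀ m : ℕ, ((q⁻¹) ^ 2) ^ m * q ^ (3 * m ^ 2 + 3 * m) =
        (q ^ 2) ^ (3 * m.choose 2 + 2 * m) := fun m => by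
      rw [hchoose, inv_pow, inv_pow]
      field_simp
      ring
    have e3 : q⁻¹ * r ^ 5 = r := by
      rw [← hr]
      field_simp
    rw [nahmF_one_one_one hr0 hr hq1]
    simp only [e1, e2, e3]
    rw [odd_product hq1 (tsum_succ_mul_qPochInf_eq_rrG hq2) hG4,
      even_product hq1 (tsum_mul_qPochInf_eq_rrH_neg hq1) hH, mul_assoc (qJ q 2 ^ 7)]
  · have e2 : ∀ m : ℕ, q ^ (3 * m ^ 2 + 3 * m) = (q ^ 2) ^ (3 * m.choose 2 + 3 * m) := fun m => by
      rw [hchoose]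
      ring
    rw [nahmF_one_one_one hr0 hr hq1]
    simp only [one_pow, one_mul, e2]
    rw [odd_product hq1 (tsum_mul_qPochInf_eq_rrH hq2) hH4,
      even_product hq1 (tsum_mul_qPochInf_eq_rrG_neg hq1) hG, mul_assoc (qJ q 2 ^ 7)]
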